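/- Let $\nu\ge 1$ and let $\mathcal A$ be the (unital) quasi-local $C^*$-algebra of a Haag–Kastler net $\mathcal O\mapsto\mathcal A(\mathcal O)$ over the bounded open subsets $\mathcal O$ of Minkowski space $\mathbb R^{1+\nu}$: the $\mathcal A(\mathcal O)$ are unital $C^*$-subalgebras of $\mathcal A$, increasing in $\mathcal O$, commuting for space-like separated regions, with norm-dense union, and the proper orthochronous Poincaré group acts on $\mathcal A$ by $*$-automorphisms $\alpha_g$ with $\alpha_g(\mathcal A(\mathcal O))=\mathcal A(g\mathcal O)$. Denote by $\tau_t$ ($t\in\mathbb R$) and $\sigma_{x}$ ($x\in\mathbb R^\nu$) the automorphisms of time and space translations and by $\lambda_v$ ($v\in\mathbb R$) those of the boosts $$(x^0,x^1,x^2,\dots,x^\nu)\mapsto(x^0\cosh v-x^1\sinh v,\;x^1\cosh v-x^0\sinh v,\;x^2,\dots,x^\nu).$$ Assume that $\|\tau_t(A)-A\|\to0$ as $t\to 0$, $\|\sigma_x(A)-A\|\to0$ as $x\to0$ and $\|\lambda_v(A)-A\|\to0$ as $v\to0$ for every $A\in\mathcal A$. Let $\omega$ be a state on $\mathcal A$ that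 is pure or a factor state (that is, the centre of $\pi_\omega(\mathcal A)''$ is trivial, $\pi_\omega$ being the GNS representation), is invariant under all space-time translations, and is extremal among the space-translation invariant states. Put $\omega_v=\omega\circ\lambda_v$. Then: (i) For every $v\in\mathbb R$, $\omega_v$ is an extremal space-translation invariant and time-translation invariant factor state. (ii) Let $f\in C^\infty(\mathbb R)$ be nonnegative, compactly supported, with $\int f(v)\,dv=1$, and let $\omega_f=\int f(v)\,\omega_v\,dv$. Then $\omega_f$ is a space-time translation invariant state, and it is not a factor state unless $\omega$ is invariant under all the boosts $\lambda_v$. Write $\omega_f$, $\sigma_x$, $\tau_t$ also for the canonical extensions to $\pi_{\omega_f}(\mathcal A)''$ (the vector state of the GNS vector, and conjugation by the unitaries that implement the translations and fix the GNS vector), and identify $A\in\mathcal A$ with $\pi_{\omega_f}(A)$. For every $B\in\mathcal A$ there is an element $B_f$ of the centre of $\pi_{\omega_f}(\mathcal A)''$, invariant under all space and time translations, such that for all $A\in\mathcal A$ (ii.a) $\omega_f(AB_f)=\omega_f(B_fA)$; (ii.b) $\lim_{|x|\to\infty}\omega_f\bigl(A\,\sigma_x(B-B_f)\bigr)=0$;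 (ii.c) $\lim_{t\to\infty}\omega_f\bigl(A\,\tau_t(B-B_f)\bigr)=0$. -/

import Mathlib

open Filter Topology MeasureTheory
open scoped ComplexOrder InnerProductSpace

noncomputable section

/-! ### Minkowski space and the Poincaré group -/

/-- Minkowski space-time with `ν` space dimensions; a point is `(t, x)`. -/
abbrev Spacetime (ν : ℕ) : Type := ℝ × EuclideanSpace ℝ (Fin ν)

namespace Spacetime

variable {ν : ℕ}

/-- The Minkowski square `t² - |x|²` (units with `c = 1`). -/
def minkowskiSq (p : Spacetime ν) : ℝ := p.1 ^ 2 - ‖p.2‖ ^ 2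

/-- The open forward light cone. -/
def forwardCone (ν : ℕ) : Set (Spacetime ν) := {p | ‖p.2‖ < p.1}

/-- Every point of `O₁` is space-like to every point of `O₂`. -/
def SpacelikeSeparated (O₁ O₂ : Set (Spacetime ν)) : Prop :=
  ∀ p ∈ O₁, ∀ q ∈ O₂, minkowskiSq (p - q) < 0

/-- The proper orthochronous Poincaré group: affine bijections whose linear part preserves the
Minkowski form, has determinant one and preserves the forward light cone. -/
def poincareGroup (ν : ℕ) : Subgroup (Spacetime ν ≃ᵃ[ℝ] Spacetime ν) where
  carrier := {g | (∀ p, minkowskiSq (g.linear p) = minkowskiSq p) ∧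
    (∀ p, g.linear p ∈ forwardCone ν ↔ p ∈ forwardCone ν) ∧
    LinearEquiv.det g.linear = 1}
  mul_mem' := by
    rintro g h ⟨g1, g2, g3⟩ ⟨h1, h2, h3⟩
    have e : (g * h).linear = g.linear * h.linear := rfl
    refine ⟨fun p => ?_, fun p => ?_, ?_⟩
    · rw [e, LinearEquiv.mul_apply, g1, h1]
    · rw [e, LinearEquiv.mul_apply, g2, h2]
    · rw [e, map_mul, g3, h3, one_mul]
  one_mem' := by
    have e : (1 : Spacetime ν ≃ᵃ[ℝ] Spacetime ν).linear = 1 := rfl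
    exact ⟨fun p => by rw [e]; rfl, fun p => by rw [e]; rfl, by rw [e, map_one]⟩
  inv_mem' := by
    rintro g ⟨g1, g2, g3⟩
    have e : (g⁻¹).linear = g.linear⁻¹ := rfl
    have k : ∀ p, g.linear (g.linear⁻¹ p) = p := fun p => g.linear.apply_symm_apply p
    refine ⟨fun p => ?_, fun p => ?_, ?_⟩
    · rw [e, ← g1, k]
    · rw [e, ← g2, k]
    · rw [e, map_inv, g3, inv_one]

/-- The translation `T(a) : p ↦ p + a` as an element of the Poincaré group. -/
def translation (a : Spacetime ν) : poincareGroup ν :=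
  ⟨AffineEquiv.constVAdd ℝ (Spacetime ν) a, by
    have e : (AffineEquiv.constVAdd ℝ (Spacetime ν) a).linear = 1 := rfl
    exact ⟨fun p => by rw [e]; rfl, fun p => by rw [e]; rfl, by rw [e, map_one]⟩⟩

variable [NeZero ν]

/-- The first spatial unit vector (index `0 : Fin ν`). -/
def e₁ : EuclideanSpace ℝ (Fin ν) := EuclideanSpace.single 0 1

/-- The velocity boost with rapidity `v` along the first axis:
`(t, x¹, x²,…) ↦ (t cosh v - x¹ sinh v, x¹ cosh v - t sinh v, x²,…)`. -/
def boostFun (v : ℝ) (p : Spacetime ν) : Spacetime ν :=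
  (p.1 * Real.cosh v - p.2 0 * Real.sinh v,
    p.2 + (p.2 0 * (Real.cosh v - 1) - p.1 * Real.sinh v) • e₁)

lemma boostFun_snd_zero (v : ℝ) (p : Spacetime ν) :
    (boostFun v p).2 0 = p.2 0 * Real.cosh v - p.1 * Real.sinh v := by
  simp [boostFun, e₁]; ring

lemma boostFun_snd_of_ne (v : ℝ) (p : Spacetime ν) {i : Fin ν} (hi : i ≠ 0) :
    (boostFun v p).2 i = p.2 i := by
  simp [boostFun, e₁, hi]

lemma boostFun_boostFun (v w : ℝ) (p : Spacetime ν) :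
    boostFun v (boostFun w p) = boostFun (v + w) p := by
  apply Prod.ext
  · change (boostFun w p).1 * Real.cosh v - (boostFun w p).2 0 * Real.sinh v = _
    rw [boostFun_snd_zero]
    simp only [boostFun, Real.cosh_add, Real.sinh_add]
    ring
  · ext i
    by_cases hi : i = 0
    · subst hi
      rw [boostFun_snd_zero, boostFun_snd_zero, boostFun_snd_zero]
      simp only [boostFun, Real.cosh_add, Real.sinh_add]
      ring
    · rw [boostFun_snd_of_ne _ _ hi, boostFun_snd_of_ne _ _ hi, boostFun_snd_of_ne _ _ hi]

lemma boostFun_zero (p : Spacetime ν) : boostFun 0 p = p := by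
  simp [boostFun]

/-- The boost as a linear automorphism of Minkowski space. -/
def boostLin (v : ℝ) : Spacetime ν ≃ₗ[ℝ] Spacetime ν where
  toFun := boostFun v
  invFun := boostFun (-v)
  left_inv p := by simp [boostFun_boostFun, boostFun_zero]
  right_inv p := by simp [boostFun_boostFun, boostFun_zero]
  map_add' p q := by
    apply Prod.ext
    · simp [boostFun]; ring
    · ext i; simp [boostFun]; ring
  map_smul' c p := by
    apply Prod.ext
    · simp [boostFun]; ring
    · ext i; simp [boostFun]; ring

lemma boostLin_mul (v w : ℝ) :
    (boostLin v * boostLin w : Spacetime ν ≃ₗ[ℝ] Spacetime ν) = boostLin (v + w) :=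
  LinearEquiv.ext fun p => boostFun_boostFun v w p

lemma boostLin_zero : (boostLin 0 : Spacetime ν ≃ₗ[ℝ] Spacetime ν) = 1 :=
  LinearEquiv.ext fun p => boostFun_zero p

/-- The reflection of the first spatial axis, used to compute the determinant of a boost. -/
def reflect : Spacetime ν ≃ₗ[ℝ] Spacetime ν :=
  LinearEquiv.ofInvolutive
    { toFun := fun p => (p.1, p.2 - (2 * p.2 0) • e₁)
      map_add' := fun p q => by
        apply Prod.ext
        · simp
        · ext i; simp; ring
      map_smul' := fun c p => by
        apply Prod.ext
        · simp
        · ext i; simp; ring }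
    (fun p => by
      apply Prod.ext
      · simp
      · ext i
        by_cases hi : i = 0
        · subst hi; simp [e₁]; ring
        · simp [e₁, hi])

lemma reflect_boost (v : ℝ) :
    (reflect * boostLin v * reflect⁻¹ : Spacetime ν ≃ₗ[ℝ] Spacetime ν) = boostLin (-v) := by
  rw [mul_inv_eq_iff_eq_mul]
  refine LinearEquiv.ext fun p => ?_
  apply Prod.ext
  · change (boostFun v p).1 = (boostFun (-v) (reflect p)).1
    simp [boostFun, reflect, e₁]; ring
  · change (boostFun v p).2 - (2 * (boostFun v p).2 0) • e₁ = (boostFun (-v) (reflect p)).2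
    ext i
    rw [boostFun_snd_zero]
    by_cases hi : i = 0
    · subst hi; simp [boostFun, reflect, e₁]; ring
    · simp [boostFun, reflect, e₁, hi]

lemma det_boostLin (v : ℝ) :
    LinearEquiv.det (boostLin v : Spacetime ν ≃ₗ[ℝ] Spacetime ν) = 1 := by
  have h1 : ∀ w : ℝ, LinearEquiv.det (boostLin w : Spacetime ν ≃ₗ[ℝ] Spacetime ν)
      * LinearEquiv.det (boostLin w : Spacetime ν ≃ₗ[ℝ] Spacetime ν) = 1 := by
    intro w
    have h := congrArg LinearEquiv.det (reflect_boost (ν := ν) w)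
    rw [map_mul, map_mul, map_inv, mul_inv_cancel_comm] at h
    nth_rewrite 2 [h]
    rw [← map_mul, boostLin_mul, add_neg_cancel, boostLin_zero, map_one]
  have h2 := h1 (v / 2)
  rwa [← map_mul, boostLin_mul, add_halves] at h2

lemma minkowskiSq_boost (v : ℝ) (p : Spacetime ν) :
    minkowskiSq (boostFun v p) = minkowskiSq p := by
  have h : ∀ (x : EuclideanSpace ℝ (Fin ν)) (c : ℝ),
      ‖x + c • e₁‖ ^ 2 = ‖x‖ ^ 2 + 2 * c * x 0 + c ^ 2 := by
    intro x c
    rw [norm_add_sq_real, norm_smul, inner_smul_right]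
    simp [e₁, EuclideanSpace.inner_single_right]
    ring
  unfold minkowskiSq
  simp only [boostFun]
  rw [h]
  linear_combination (p.1 ^ 2 - p.2 0 ^ 2) * Real.cosh_sq v

lemma forwardCone_boost_aux (v : ℝ) (p : Spacetime ν) (hp : p ∈ forwardCone ν) :
    boostFun v p ∈ forwardCone ν := by
  have hp' : ‖p.2‖ < p.1 := hp
  have hx : |p.2 0| ≤ ‖p.2‖ := by simpa using PiLp.norm_apply_le p.2 0
  have hsc : |Real.sinh v| < Real.cosh v := by
    rw [← abs_of_pos (Real.cosh_pos v)]
    apply sq_lt_sq.mp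
    nlinarith [Real.cosh_sq v]
  have ht : 0 < (boostFun v p).1 := by
    change 0 < p.1 * Real.cosh v - p.2 0 * Real.sinh v
    have h1 : p.2 0 * Real.sinh v ≤ ‖p.2‖ * |Real.sinh v| :=
      (le_abs_self _).trans (by rw [abs_mul]; gcongr)
    have h2 : ‖p.2‖ * |Real.sinh v| ≤ ‖p.2‖ * Real.cosh v := by gcongr
    have h3 : ‖p.2‖ * Real.cosh v < p.1 * Real.cosh v := by
      have := Real.cosh_pos v
      gcongr
    linarith
  have hq := minkowskiSq_boost v p
  unfold minkowskiSq at hq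
  change ‖(boostFun v p).2‖ < (boostFun v p).1
  apply lt_of_pow_lt_pow_left₀ 2 ht.le
  nlinarith [norm_nonneg p.2]

/-- The velocity boost `L(v)` as an element of the Poincaré group. -/
def boost (v : ℝ) : poincareGroup ν :=
  ⟨(boostLin v).toAffineEquiv, by
    have e : ((boostLin v : Spacetime ν ≃ₗ[ℝ] Spacetime ν).toAffineEquiv).linear
      = boostLin v := rfl
    refine ⟨fun p => ?_, fun p => ⟨fun h => ?_, fun h => ?_⟩, ?_⟩
    · rw [e]; exact minkowskiSq_boost v p
    · have := forwardCone_boost_aux (-v) _ h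
      rw [e] at this
      change boostFun (-v) (boostFun v p) ∈ _ at this
      simpa [boostFun_boostFun, boostFun_zero] using this
    · rw [e]; exact forwardCone_boost_aux v p h
    · rw [e]; exact det_boostLin v⟩

lemma boost_mul_boost (v w : ℝ) : (boost v * boost w : poincareGroup ν) = boost (v + w) :=
  Subtype.ext (AffineEquiv.ext fun p => boostFun_boostFun v w p)

lemma boost_zero : (boost 0 : poincareGroup ν) = 1 :=
  Subtype.ext (AffineEquiv.ext fun p => boostFun_zero p)

end Spacetime

/-! ### States, GNS representation, factors -/

section States

variable {A : Type*} [CStarAlgebra A] [PartialOrder A] [StarOrderedRing A]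

/-- A state: a normalised positive linear functional. -/
def IsState (ω : A →ₚ[ℂ] ℂ) : Prop := ω 1 = 1

/-- `ω` belongs to `S` and is not a nontrivial convex combination of elements of `S`. -/
def IsExtremalIn (S : Set (A →ₚ[ℂ] ℂ)) (ω : A →ₚ[ℂ] ℂ) : Prop :=
  ω ∈ S ∧ ∀ φ ∈ S, ∀ ψ ∈ S, ∀ s : ℝ, 0 < s → s < 1 →
    (∀ a, ω a = (s : ℂ) * φ a + ((1 - s : ℝ) : ℂ) * ψ a) → φ = ω ∧ ψ = ω

/-- A pure state: an extreme point of the set of all states. -/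
def IsPureState (ω : A →ₚ[ℂ] ℂ) : Prop := IsExtremalIn {φ | IsState φ} ω

/-- The pullback `ω ∘ γ` of a positive functional by a `*`-automorphism. -/
def pullback (ω : A →ₚ[ℂ] ℂ) (γ : A ≃⋆ₐ[ℂ] A) : A →ₚ[ℂ] ℂ :=
  PositiveLinearMap.mk₀
    { toFun := fun a => ω (γ a)
      map_add' := fun a b => by simp
      map_smul' := fun c a => by simp }
    (fun a ha => ω.map_nonneg (map_nonneg γ ha))

@[simp] lemma pullback_apply (ω : A →ₚ[ℂ] ℂ) (γ : A ≃⋆ₐ[ℂ] A) (a : A) :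
    pullback ω γ a = ω (γ a) := rfl

/-- The cyclic vector `Ω_ω` of the GNS representation, the class of `1`. -/
def gnsVector (ω : A →ₚ[ℂ] ℂ) : ω.GNS := ((ω.toPreGNS 1 : ω.PreGNS) : ω.GNS)

/-- The enveloping von Neumann algebra `π_ω(A)''` on the GNS Hilbert space. -/
def gnsVN (ω : A →ₚ[ℂ] ℂ) : VonNeumannAlgebra ω.GNS where
  toStarSubalgebra := StarSubalgebra.centralizer ℂ
    (StarSubalgebra.centralizer ℂ (Set.range ω.gnsStarAlgHom) : Set (ω.GNS →L[ℂ] ω.GNS))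
  centralizer_centralizer' := by simp

/-- The centre of the enveloping von Neumann algebra. -/
def gnsCenter (ω : A →ₚ[ℂ] ℂ) : Set (ω.GNS →L[ℂ] ω.GNS) :=
  {T | T ∈ gnsVN ω ∧ T ∈ (gnsVN ω).commutant}

/-- A factor (primary) state: the centre of `π_ω(A)''` consists of the scalars. -/
def IsFactorState (ω : A →ₚ[ℂ] ℂ) : Prop :=
  IsState ω ∧ ∀ T ∈ gnsCenter ω, ∃ c : ℂ, T = c • (1 : ω.GNS →L[ℂ] ω.GNS)

/-- The extension `T ↦ (Ω_ω, T Ω_ω)` of `ω` to bounded operators on the GNS space. -/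
def gnsExt (ω : A →ₚ[ℂ] ℂ) (T : ω.GNS →L[ℂ] ω.GNS) : ℂ := ⟪gnsVector ω, T (gnsVector ω)⟫_ℂ

lemma gnsExt_apply (ω : A →ₚ[ℂ] ℂ) (a : A) : gnsExt ω (ω.gnsStarAlgHom a) = ω a := by
  simp [gnsExt, gnsVector, PositiveLinearMap.preGNS_inner_def]

variable (ω : A →ₚ[ℂ] ℂ)

/-- `π(a)Ω ↦ π(γ a)Ω` on the pre-Hilbert space. -/
def preGnsIso (γ : A ≃⋆ₐ[ℂ] A) (h : ∀ a, ω (γ a) = ω a) : ω.PreGNS →L[ℂ] ω.PreGNS :=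
  LinearMap.mkContinuous
    { toFun := fun x => ω.toPreGNS (γ (ω.ofPreGNS x))
      map_add' := fun x y => by simp
      map_smul' := fun c x => by simp } 1 (fun x => by
        rw [PositiveLinearMap.preGNS_norm_def, PositiveLinearMap.preGNS_norm_def]
        simp [← map_star, ← map_mul, h])

lemma preGnsIso_apply (γ : A ≃⋆ₐ[ℂ] A) (h : ∀ a, ω (γ a) = ω a) (x : ω.PreGNS) :
    preGnsIso ω γ h x = ω.toPreGNS (γ (ω.ofPreGNS x)) := rfl

/-- The unitary on the GNS space with `U π(a)Ω = π(γ a)Ω`, for an automorphism `γ` leaving `ω`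
invariant. -/
def gnsUnitary (γ : A ≃⋆ₐ[ℂ] A) (h : ∀ a, ω (γ a) = ω a) :
    unitary (ω.GNS →L[ℂ] ω.GNS) :=
  ⟨(preGnsIso ω γ h).completion, by
    have h' : ∀ a, ω (γ.symm a) = ω a := fun a => by
      rw [← h (γ.symm a), StarAlgEquiv.apply_symm_apply]
    have hadj : star (preGnsIso ω γ h).completion = (preGnsIso ω γ.symm h').completion := by
      symm
      refine (ContinuousLinearMap.eq_adjoint_iff _ _).mpr fun x y => ?_
      induction x, y using UniformSpace.Completion.induction_on₂ with
      | hp => apply isClosed_eq <;> fun_prop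
      | ih x y =>
        simp only [ContinuousLinearMap.completion_apply_coe, UniformSpace.Completion.inner_coe,
          PositiveLinearMap.preGNS_inner_def, preGnsIso_apply,
          PositiveLinearMap.ofPreGNS_toPreGNS]
        rw [← h (star (γ.symm _) * _)]
        simp [map_star]
    rw [Unitary.mem_iff, hadj]
    constructor
    · ext x
      induction x using UniformSpace.Completion.induction_on with
      | hp => apply isClosed_eq <;> fun_prop
      | ih x => simp [preGnsIso_apply]
    · ext x
      induction x using UniformSpace.Completion.induction_on with
      | hp => apply isClosed_eq <;> fun_prop
      | ih x => simp [preGnsIso_apply]⟩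

/-- The extension `T ↦ U T U*` of an `ω`-preserving automorphism to operators on the GNS space. -/
def gnsAut (γ : A ≃⋆ₐ[ℂ] A) (h : ∀ a, ω (γ a) = ω a) :
    (ω.GNS →L[ℂ] ω.GNS) ≃⋆ₐ[ℂ] (ω.GNS →L[ℂ] ω.GNS) :=
  Unitary.conjStarAlgAut ℂ (ω.GNS →L[ℂ] ω.GNS) (gnsUnitary ω γ h)

lemma gnsUnitary_apply_coe (γ : A ≃⋆ₐ[ℂ] A) (h : ∀ a, ω (γ a) = ω a) (x : ω.PreGNS) :
    (gnsUnitary ω γ h : ω.GNS →L[ℂ] ω.GNS) (x : ω.GNS)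
      = (ω.toPreGNS (γ (ω.ofPreGNS x)) : ω.PreGNS) := by
  simp [gnsUnitary, preGnsIso_apply]

lemma gnsAut_gnsStarAlgHom (γ : A ≃⋆ₐ[ℂ] A) (h : ∀ a, ω (γ a) = ω a) (a : A) :
    gnsAut ω γ h (ω.gnsStarAlgHom a) = ω.gnsStarAlgHom (γ a) := by
  have key : (gnsUnitary ω γ h : ω.GNS →L[ℂ] ω.GNS) * ω.gnsStarAlgHom a
      = ω.gnsStarAlgHom (γ a) * (gnsUnitary ω γ h : ω.GNS →L[ℂ] ω.GNS) := by
    ext x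
    induction x using UniformSpace.Completion.induction_on with
    | hp => apply isClosed_eq <;> fun_prop
    | ih x => simp [gnsUnitary_apply_coe]
  rw [gnsAut, Unitary.conjStarAlgAut_apply, key, mul_assoc, Unitary.mul_star_self_of_mem
    (gnsUnitary ω γ h).2, mul_one]

end States

/-! ### Haag–Kastler nets -/

open Spacetime

/-- A Haag–Kastler net of local observable algebras, with quasi-local algebra `A`. Only the values
of `localAlg` on bounded open regions matter. -/
structure HaagKastlerNet (ν : ℕ) (A : Type*) [CStarAlgebra A] where
  /-- the local algebras -/
  localAlg : Set (Spacetime ν) → StarSubalgebra ℂ A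
  /-- local algebras are C*-algebras -/
  isClosed_localAlg : ∀ O, IsOpen O → Bornology.IsBounded O → IsClosed (localAlg O : Set A)
  /-- isotony -/
  isotony : ∀ O₁ O₂, IsOpen O₁ → Bornology.IsBounded O₁ → IsOpen O₂ → Bornology.IsBounded O₂ →
    O₁ ⊆ O₂ → localAlg O₁ ≤ localAlg O₂
  /-- local commutativity -/
  locality : ∀ O₁ O₂, IsOpen O₁ → Bornology.IsBounded O₁ → IsOpen O₂ → Bornology.IsBounded O₂ →
    SpacelikeSeparated O₁ O₂ → ∀ a ∈ localAlg O₁, ∀ b ∈ localAlg O₂, a * b = b * a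
  /-- `A` is generated in norm by the local algebras -/
  quasilocal : Dense {a : A | ∃ O, IsOpen O ∧ Bornology.IsBounded O ∧ a ∈ localAlg O}
  /-- the action of the Poincaré group by automorphisms -/
  act : poincareGroup ν →* (A ≃⋆ₐ[ℂ] A)
  /-- covariance -/
  covariance : ∀ (g : poincareGroup ν) (O), IsOpen O → Bornology.IsBounded O →
    (localAlg ((g : Spacetime ν ≃ᵃ[ℝ] Spacetime ν) '' O) : Set A) = act g '' (localAlg O : Set A)

/-- A smearing function: smooth, compactly supported, nonnegative and of integral one. -/
structure SmearingFunction where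
  /-- the underlying function -/
  toFun : ℝ → ℝ
  smooth : ContDiff ℝ ((⊤ : ℕ∞) : WithTop ℕ∞) toFun
  hasCompactSupport : HasCompactSupport toFun
  nonneg : ∀ v, 0 ≤ toFun v
  integral_eq_one : ∫ v, toFun v = 1

namespace HaagKastlerNet

variable {ν : ℕ} {A : Type*} [CStarAlgebra A]

/-- Space-time translations `ξ_a`. -/
def ξ (N : HaagKastlerNet ν A) (a : Spacetime ν) : A ≃⋆ₐ[ℂ] A := N.act (translation a)

/-- Time translations `τ_t`. -/
def τ (N : HaagKastlerNet ν A) (t : ℝ) : A ≃⋆ₐ[ℂ] A := N.ξ (t, 0)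

/-- Space translations `σ_x`. -/
def σ (N : HaagKastlerNet ν A) (x : EuclideanSpace ℝ (Fin ν)) : A ≃⋆ₐ[ℂ] A := N.ξ (0, x)

/-- Norm continuity of `t ↦ τ_t(a)` and `x ↦ σ_x(a)`. -/
def ContinuousTranslations (N : HaagKastlerNet ν A) : Prop :=
  (∀ a, Tendsto (fun t : ℝ => ‖N.τ t a - a‖) (𝓝 0) (𝓝 0)) ∧
  (∀ a, Tendsto (fun x : EuclideanSpace ℝ (Fin ν) => ‖N.σ x a - a‖) (𝓝 0) (𝓝 0))

section Boost

variable [NeZero ν]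

/-- The boost automorphisms `λ_v` along the first axis. -/
def boostAut (N : HaagKastlerNet ν A) (v : ℝ) : A ≃⋆ₐ[ℂ] A := N.act (boost v)

/-- Norm continuity of `v ↦ λ_v(a)`. -/
def ContinuousBoosts (N : HaagKastlerNet ν A) : Prop :=
  ∀ a, Tendsto (fun v : ℝ => ‖N.boostAut v a - a‖) (𝓝 0) (𝓝 0)

lemma boostAut_add (N : HaagKastlerNet ν A) (v w : ℝ) (a : A) :
    N.boostAut (v + w) a = N.boostAut v (N.boostAut w a) := by
  simp only [boostAut, ← boost_mul_boost, map_mul]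
  rfl

lemma ContinuousBoosts.continuous {N : HaagKastlerNet ν A} (h : N.ContinuousBoosts) (a : A) :
    Continuous fun v => N.boostAut v a := by
  rw [continuous_iff_continuousAt]
  intro v
  rw [ContinuousAt, tendsto_iff_norm_sub_tendsto_zero]
  have h1 : Tendsto (fun w : ℝ => w - v) (𝓝 v) (𝓝 0) := by
    have : Continuous fun w : ℝ => w - v := by fun_prop
    simpa using this.tendsto v
  refine ((h a).comp h1).congr fun w => ?_
  have e : N.boostAut w a = N.boostAut v (N.boostAut (w - v) a) := by
    rw [← boostAut_add]; congr 2; ring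
  rw [Function.comp_apply, e, ← map_sub]
  exact (NonUnitalStarAlgHom.norm_map (N.boostAut v) (N.boostAut v).injective _).symm

end Boost

variable [PartialOrder A] [StarOrderedRing A]

/-- Invariance under all space-time translations. -/
def IsTranslationInvariant (N : HaagKastlerNet ν A) (ω : A →ₚ[ℂ] ℂ) : Prop :=
  ∀ p a, ω (N.ξ p a) = ω a

/-- Invariance under time translations. -/
def IsTimeInvariant (N : HaagKastlerNet ν A) (ω : A →ₚ[ℂ] ℂ) : Prop :=
  ∀ t a, ω (N.τ t a) = ω a

/-- Invariance under space translations. -/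
def IsSpaceInvariant (N : HaagKastlerNet ν A) (ω : A →ₚ[ℂ] ℂ) : Prop :=
  ∀ x a, ω (N.σ x a) = ω a

/-- An extreme point of the set of space-translation invariant states. -/
def IsExtremalSpaceInvariant (N : HaagKastlerNet ν A) (ω : A →ₚ[ℂ] ℂ) : Prop :=
  IsExtremalIn {φ | IsState φ ∧ N.IsSpaceInvariant φ} ω

/-- The extension of `σ_x` to operators on the GNS space of a translation invariant state. -/
def σExt (N : HaagKastlerNet ν A) {ω : A →ₚ[ℂ] ℂ} (h : N.IsTranslationInvariant ω)
    (x : EuclideanSpace ℝ (Fin ν)) : (ω.GNS →L[ℂ] ω.GNS) ≃⋆ₐ[ℂ] (ω.GNS →L[ℂ] ω.GNS) :=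
  gnsAut ω (N.σ x) (h (0, x))

/-- The extension of `τ_t` to operators on the GNS space of a translation invariant state. -/
def τExt (N : HaagKastlerNet ν A) {ω : A →ₚ[ℂ] ℂ} (h : N.IsTranslationInvariant ω)
    (t : ℝ) : (ω.GNS →L[ℂ] ω.GNS) ≃⋆ₐ[ℂ] (ω.GNS →L[ℂ] ω.GNS) :=
  gnsAut ω (N.τ t) (h (t, 0))

variable [NeZero ν]

/-- The boosted functional `ω_v = ω ∘ λ_v`. -/
def boosted (N : HaagKastlerNet ν A) (ω : A →ₚ[ℂ] ℂ) (v : ℝ) : A →ₚ[ℂ] ℂ :=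
  pullback ω (N.boostAut v)

lemma integrable_smear {N : HaagKastlerNet ν A} (h : N.ContinuousBoosts) (ω : A →ₚ[ℂ] ℂ)
    (f : SmearingFunction) (a : A) :
    Integrable fun v : ℝ => (f.toFun v : ℂ) * N.boosted ω v a := by
  have hf : Continuous f.toFun := f.smooth.continuous
  have hω : Continuous fun v : ℝ => N.boosted ω v a :=
    (map_continuous ω).comp (h.continuous a)
  apply Continuous.integrable_of_hasCompactSupport
  · fun_prop
  · apply HasCompactSupport.mul_right
    exact f.hasCompactSupport.comp_left (g := fun r : ℝ => (r : ℂ)) Complex.ofReal_zero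

/-- The smeared functional `ω_f = ∫ f(v) ω_v dv`. -/
def smeared (N : HaagKastlerNet ν A) (h : N.ContinuousBoosts) (ω : A →ₚ[ℂ] ℂ)
    (f : SmearingFunction) : A →ₚ[ℂ] ℂ :=
  PositiveLinearMap.mk₀
    { toFun := fun a => ∫ v, (f.toFun v : ℂ) * N.boosted ω v a
      map_add' := fun a b => by
        simp only [map_add, mul_add]
        exact integral_add (integrable_smear h ω f a) (integrable_smear h ω f b)
      map_smul' := fun c a => by
        simp only [map_smul, smul_eq_mul, mul_left_comm _ c, RingHom.id_apply]
        exact integral_const_mul c _ }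
    (fun a ha => by
      refine integral_nonneg fun v => mul_nonneg ?_ ((N.boosted ω v).map_nonneg ha)
      exact Complex.zero_le_real.mpr (f.nonneg v))

end HaagKastlerNet

end

/-! A pure state has scalar commutant, hence is a factor state (`IsPureState.isFactorState`), so
only factor states matter. Locality and quasi-locality make commutators vanish in norm when one
observable is translated so that `|x| - |t| → ∞`. Weak limits of such translates therefore commute
with the algebra and with its commutant: they are central. In an invariant factor state they are
scalars, and invariance fixes the scalar as the expectation value
(`tendsto_inner_of_isFactorState`). This clustering gives extremality through `eq_of_dominated`.
Boosts normalise the translations and transport the factor property, so every `ω_v` is again such a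
state, which is (i).

For (ii), clustering of each `ω_v` and dominated convergence give `ω_f(A σ_x(B)) → ∫ f(v) ω_v(A)
ω_v(B) dv`. If `ω_f` were a factor state the limit would also be `ω_f(A) ω_f(B)`; then `v ↦ ω_v(B)`
has zero variance under `f(v) dv`, so `ω_v` is constant where `f ≠ 0`, and the rapidities fixing `ω`
form an open subgroup of `ℝ`, hence all of it. In general `B_f` is a weak limit of the `σ_x(B)`; its
matrix elements are the integrals above, which gives its invariance and (ii.b).

The time limit (ii.c) needs no clustering in time of any single `ω_v`. For `v ≠ w` the time axes of
the two frames separate in a space-like direction, so the vectors `π(λ_v τ_t B)Ω - ω_v(B)Ω` become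
pairwise orthogonal for different `v` as `t → ∞`. Their averages over `v` then tend to zero, because
the diagonal `v = w` is a null set (`tendsto_setIntegral_zero_of_asymptotically_orthogonal`). Thus
the limit in time equals the limit in space. -/

section GNS

variable {A : Type*} [CStarAlgebra A] [PartialOrder A] [StarOrderedRing A]

/-! ### GNS representations, their centres, factor states and pure states -/

lemma gnsStarAlgHom_gnsVector (ω : A →ₚ[ℂ] ℂ) (a : A) :
    ω.gnsStarAlgHom a (gnsVector ω) = ((ω.toPreGNS a : ω.PreGNS) : ω.GNS) := by
  simp [gnsVector]

lemma gnsStarAlgHom_one_gnsVector (ω : A →ₚ[ℂ] ℂ) :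
    ω.gnsStarAlgHom 1 (gnsVector ω) = gnsVector ω := by
  rw [map_one]; rfl

lemma inner_gns (ω : A →ₚ[ℂ] ℂ) (a b : A) :
    ⟪ω.gnsStarAlgHom a (gnsVector ω), ω.gnsStarAlgHom b (gnsVector ω)⟫_ℂ = ω (star a * b) := by
  simp only [gnsStarAlgHom_gnsVector, UniformSpace.Completion.inner_coe,
    PositiveLinearMap.preGNS_inner_def, PositiveLinearMap.ofPreGNS_toPreGNS]

lemma inner_gnsStarAlgHom_left (ω : A →ₚ[ℂ] ℂ) (a : A) (x y : ω.GNS) :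
    ⟪ω.gnsStarAlgHom a x, y⟫_ℂ = ⟪x, ω.gnsStarAlgHom (star a) y⟫_ℂ := by
  rw [map_star, ContinuousLinearMap.star_eq_adjoint, ContinuousLinearMap.adjoint_inner_right]

lemma denseRange_gns (ω : A →ₚ[ℂ] ℂ) :
    DenseRange fun a => ω.gnsStarAlgHom a (gnsVector ω) := by
  simp only [gnsStarAlgHom_gnsVector]
  exact (UniformSpace.Completion.denseRange_coe (α := ω.PreGNS)).comp
    ω.toPreGNS.surjective.denseRange (UniformSpace.Completion.continuous_coe _)

lemma gns_ext {ω : A →ₚ[ℂ] ℂ} {E : Type*} [NormedAddCommGroup E] [NormedSpace ℂ E]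
    {S T : ω.GNS →L[ℂ] E}
    (h : ∀ a, S (ω.gnsStarAlgHom a (gnsVector ω)) = T (ω.gnsStarAlgHom a (gnsVector ω))) :
    S = T :=
  ContinuousLinearMap.coeFn_injective <|
    (denseRange_gns ω).equalizer S.continuous T.continuous (funext h)

lemma gns_ext_inner {ω : A →ₚ[ℂ] ℂ} {S T : ω.GNS →L[ℂ] ω.GNS}
    (h : ∀ a b, ⟪ω.gnsStarAlgHom a (gnsVector ω), S (ω.gnsStarAlgHom b (gnsVector ω))⟫_ℂ =
      ⟪ω.gnsStarAlgHom a (gnsVector ω), T (ω.gnsStarAlgHom b (gnsVector ω))⟫_ℂ) :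
    S = T := by
  refine gns_ext fun b => ext_inner_left ℂ fun x => ?_
  refine (denseRange_gns ω).induction_on (p := fun x => ⟪x, S _⟫_ℂ = ⟪x, T _⟫_ℂ) x
    (isClosed_eq (by fun_prop) (by fun_prop)) fun a => h a b

lemma norm_gnsStarAlgHom_le (ω : A →ₚ[ℂ] ℂ) (a : A) : ‖ω.gnsStarAlgHom a‖ ≤ ‖a‖ :=
  NonUnitalStarAlgHom.norm_apply_le ω.gnsStarAlgHom a

lemma norm_gnsVector {ω : A →ₚ[ℂ] ℂ} (h : IsState ω) : ‖gnsVector ω‖ = 1 := by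
  have h1 := inner_gns ω 1 1
  rw [gnsStarAlgHom_one_gnsVector, inner_self_eq_norm_sq_to_K, star_one, one_mul, h] at h1
  have h2 : ‖gnsVector ω‖ ^ 2 = 1 := Complex.ofReal_injective (by simpa using h1)
  exact (pow_eq_one_iff_of_nonneg (norm_nonneg _) two_ne_zero).1 h2

lemma norm_gns_le {ω : A →ₚ[ℂ] ℂ} (h : IsState ω) (a : A) :
    ‖ω.gnsStarAlgHom a (gnsVector ω)‖ ≤ ‖a‖ := by
  refine ((ω.gnsStarAlgHom a).le_opNorm _).trans ?_
  rw [norm_gnsVector h, mul_one]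
  exact norm_gnsStarAlgHom_le ω a

lemma eq_inner_gnsVector (ω : A →ₚ[ℂ] ℂ) (a : A) :
    ω a = ⟪gnsVector ω, ω.gnsStarAlgHom a (gnsVector ω)⟫_ℂ :=
  (gnsExt_apply ω a).symm

lemma IsState.norm_apply_le {ω : A →ₚ[ℂ] ℂ} (h : IsState ω) (a : A) : ‖ω a‖ ≤ ‖a‖ := by
  rw [eq_inner_gnsVector]
  refine (norm_inner_le_norm _ _).trans ?_
  rw [norm_gnsVector h, one_mul]
  exact norm_gns_le h a

lemma mem_centralizer_range_gns {ω : A →ₚ[ℂ] ℂ} {T : ω.GNS →L[ℂ] ω.GNS} :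
    T ∈ StarSubalgebra.centralizer ℂ (Set.range ω.gnsStarAlgHom) ↔
      ∀ a, Commute T (ω.gnsStarAlgHom a) := by
  rw [StarSubalgebra.mem_centralizer_iff]
  constructor
  · intro h a
    exact (h _ ⟨a, rfl⟩).1.symm
  · rintro h _ ⟨a, rfl⟩
    rw [← map_star]
    exact ⟨(h a).eq.symm, (h _).eq.symm⟩

/-- The commutant of the represented algebra is closed under `star`, so the adjoint half of the
centralizer condition is automatic. -/
lemma mem_gnsVN_iff {ω : A →ₚ[ℂ] ℂ} {T : ω.GNS →L[ℂ] ω.GNS} :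
    T ∈ gnsVN ω ↔ ∀ S, (∀ a, Commute S (ω.gnsStarAlgHom a)) → Commute T S := by
  change T ∈ StarSubalgebra.centralizer ℂ
    (StarSubalgebra.centralizer ℂ (Set.range ω.gnsStarAlgHom) : Set (ω.GNS →L[ℂ] ω.GNS)) ↔ _
  rw [StarSubalgebra.mem_centralizer_iff]
  constructor
  · intro h S hS
    exact (h S (mem_centralizer_range_gns.2 hS)).1.symm
  · intro h S hS
    exact ⟨(h S (mem_centralizer_range_gns.1 hS)).eq.symm,
      (h _ (mem_centralizer_range_gns.1 (star_mem hS))).eq.symm⟩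

lemma gnsStarAlgHom_mem_gnsVN (ω : A →ₚ[ℂ] ℂ) (a : A) : ω.gnsStarAlgHom a ∈ gnsVN ω :=
  mem_gnsVN_iff.2 fun _ hS => (hS a).symm

/-- The centre consists of the operators commuting with the algebra and with its commutant. -/
lemma mem_gnsCenter_iff {ω : A →ₚ[ℂ] ℂ} {T : ω.GNS →L[ℂ] ω.GNS} :
    T ∈ gnsCenter ω ↔ (∀ S, (∀ a, Commute S (ω.gnsStarAlgHom a)) → Commute T S) ∧
      ∀ a, Commute T (ω.gnsStarAlgHom a) := by
  change T ∈ gnsVN ω ∧ T ∈ (gnsVN ω).commutant ↔ _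
  rw [mem_gnsVN_iff, VonNeumannAlgebra.mem_commutant_iff]
  refine and_congr_right fun _ => ⟨fun h a => ?_, fun h S hS => ?_⟩
  · exact (h _ (gnsStarAlgHom_mem_gnsVN ω a)).symm
  · exact (mem_gnsVN_iff.1 hS T h).eq

/-- The bounded operator `π_ω(a)Ω_ω ↦ π_φ(γ a)Ω_φ`, for `φ ∘ γ` dominated by a multiple of `ω`. -/
noncomputable def gnsMap (ω φ : A →ₚ[ℂ] ℂ) (γ : A ≃⋆ₐ[ℂ] A) (C : ℝ)
    (h : ∀ a, (φ (γ (star a * a))).re ≤ C * (ω (star a * a)).re) : ω.GNS →L[ℂ] φ.GNS :=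
  (LinearMap.mkContinuous
    { toFun := fun x => φ.toPreGNS (γ (ω.ofPreGNS x))
      map_add' := fun x y => by simp
      map_smul' := fun c x => by simp } (√C) (fun x => by
        rw [PositiveLinearMap.preGNS_norm_def, PositiveLinearMap.preGNS_norm_def]
        have h0 : 0 ≤ (ω (star (ω.ofPreGNS x) * ω.ofPreGNS x)).re :=
          (Complex.nonneg_iff.1 (ω.map_nonneg (star_mul_self_nonneg _))).1
        rw [← Real.sqrt_mul' C h0]
        apply Real.sqrt_le_sqrt
        simpa [map_star] using h (ω.ofPreGNS x)) : ω.PreGNS →L[ℂ] φ.PreGNS).completion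

lemma gnsMap_apply {ω φ : A →ₚ[ℂ] ℂ} {γ : A ≃⋆ₐ[ℂ] A} {C : ℝ}
    (h : ∀ a, (φ (γ (star a * a))).re ≤ C * (ω (star a * a)).re) (a : A) :
    gnsMap ω φ γ C h (ω.gnsStarAlgHom a (gnsVector ω)) =
      φ.gnsStarAlgHom (γ a) (gnsVector φ) := by
  rw [gnsStarAlgHom_gnsVector, gnsStarAlgHom_gnsVector, gnsMap,
    ContinuousLinearMap.completion_apply_coe]
  rfl

lemma gnsMap_gnsStarAlgHom {ω φ : A →ₚ[ℂ] ℂ} {γ : A ≃⋆ₐ[ℂ] A} {C : ℝ}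
    (h : ∀ a, (φ (γ (star a * a))).re ≤ C * (ω (star a * a)).re) (a : A) (x : ω.GNS) :
    gnsMap ω φ γ C h (ω.gnsStarAlgHom a x) = φ.gnsStarAlgHom (γ a) (gnsMap ω φ γ C h x) := by
  have : gnsMap ω φ γ C h ∘L ω.gnsStarAlgHom a =
      φ.gnsStarAlgHom (γ a) ∘L gnsMap ω φ γ C h := by
    refine gns_ext fun b => ?_
    simp only [ContinuousLinearMap.comp_apply]
    rw [← mul_apply_eq_comp, ← map_mul, gnsMap_apply, gnsMap_apply, map_mul, map_mul,
      mul_apply_eq_comp]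
  exact DFunLike.congr_fun this x

/-- The factor property is invariant under `*`-automorphisms. -/
lemma IsFactorState.pullback {ω : A →ₚ[ℂ] ℂ} (hω : IsFactorState ω) (γ : A ≃⋆ₐ[ℂ] A) :
    IsFactorState (pullback ω γ) := by
  refine ⟨by simpa [IsState] using hω.1, ?_⟩
  set φ := _root_.pullback ω γ with hφ
  intro T hT
  have h1 : ∀ a, (ω (γ (star a * a))).re ≤ 1 * (φ (star a * a)).re := fun a => by simp [hφ]
  have h2 : ∀ a, (φ (γ.symm (star a * a))).re ≤ 1 * (ω (star a * a)).re := fun a => by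
    rw [hφ, pullback_apply, StarAlgEquiv.apply_symm_apply, one_mul]
  -- `V` and `W` are mutually inverse and intertwine the two representations up to `γ`; conjugation
  -- by them carries central elements to central elements.
  set V := gnsMap φ ω γ 1 h1
  set W := gnsMap ω φ γ.symm 1 h2
  have hVW : ∀ x, V (W x) = x := fun x => by
    have : V ∘L W = ContinuousLinearMap.id ℂ _ := gns_ext fun b => by
      rw [ContinuousLinearMap.comp_apply, gnsMap_apply, gnsMap_apply,
        StarAlgEquiv.apply_symm_apply, ContinuousLinearMap.id_apply]
    exact DFunLike.congr_fun this x
  have hWV : ∀ x, W (V x) = x := fun x => by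
    have : W ∘L V = ContinuousLinearMap.id ℂ _ := gns_ext fun b => by
      rw [ContinuousLinearMap.comp_apply, gnsMap_apply, gnsMap_apply,
        StarAlgEquiv.symm_apply_apply, ContinuousLinearMap.id_apply]
    exact DFunLike.congr_fun this x
  have hV : ∀ a x, V (φ.gnsStarAlgHom a x) = ω.gnsStarAlgHom (γ a) (V x) :=
    gnsMap_gnsStarAlgHom h1
  have hW : ∀ a x, W (ω.gnsStarAlgHom a x) = φ.gnsStarAlgHom (γ.symm a) (W x) :=
    gnsMap_gnsStarAlgHom h2
  rw [mem_gnsCenter_iff] at hT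
  have hmem : V ∘L T ∘L W ∈ gnsCenter ω := by
    refine mem_gnsCenter_iff.2 ⟨fun S hS => ContinuousLinearMap.ext fun x => ?_,
      fun a => ContinuousLinearMap.ext fun x => ?_⟩
    · have hS' : ∀ a, Commute (W ∘L S ∘L V) (φ.gnsStarAlgHom a) := fun a =>
        ContinuousLinearMap.ext fun x => by
          have := DFunLike.congr_fun (hS (γ a)).eq (V x)
          simp only [mul_apply_eq_comp, ContinuousLinearMap.comp_apply] at this ⊢
          rw [hV, this, hW, StarAlgEquiv.symm_apply_apply]
      have := congrArg V (DFunLike.congr_fun (hT.1 _ hS').eq (W x))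
      simpa [hWV, hVW] using this
    · have := congrArg V (DFunLike.congr_fun (hT.2 (γ.symm a)).eq (W x))
      simp only [mul_apply_eq_comp, ContinuousLinearMap.comp_apply] at this ⊢
      rw [hW, this, hV, StarAlgEquiv.apply_symm_apply]
  obtain ⟨c, hc⟩ := hω.2 _ hmem
  refine ⟨c, ContinuousLinearMap.ext fun x => ?_⟩
  have := congrArg W (DFunLike.congr_fun hc (V x))
  simpa [hWV] using this

/-- The positive functional `a ↦ r ⟪Ω, S π(a) Ω⟫` of a positive operator `S` in the commutant. -/
noncomputable def commutantFunctional (ω : A →ₚ[ℂ] ℂ) (S : ω.GNS →L[ℂ] ω.GNS)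
    (hS : ∀ a, Commute S (ω.gnsStarAlgHom a)) (hpos : ∀ x, 0 ≤ ⟪x, S x⟫_ℂ)
    (r : ℝ) (hr : 0 ≤ r) : A →ₚ[ℂ] ℂ :=
  PositiveLinearMap.mk₀
    { toFun := fun a => (r : ℂ) * ⟪gnsVector ω, S (ω.gnsStarAlgHom a (gnsVector ω))⟫_ℂ
      map_add' := fun a b => by
        simp only [map_add, add_apply, inner_add_right, mul_add]
      map_smul' := fun c a => by
        simp only [map_smul, smul_apply, inner_smul_right, RingHom.id_apply, smul_eq_mul]
        ring }
    (fun a ha => by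
      obtain ⟨b, rfl⟩ := CStarAlgebra.nonneg_iff_eq_star_mul_self.1 ha
      refine mul_nonneg (Complex.zero_le_real.2 hr) ?_
      have := DFunLike.congr_fun (hS (star b)).eq (ω.gnsStarAlgHom b (gnsVector ω))
      simp only [mul_apply_eq_comp] at this
      rw [map_mul, mul_apply_eq_comp, this, ← inner_gnsStarAlgHom_left]
      exact hpos _)

lemma commutantFunctional_apply {ω : A →ₚ[ℂ] ℂ} {S : ω.GNS →L[ℂ] ω.GNS}
    (hS : ∀ a, Commute S (ω.gnsStarAlgHom a)) (hpos : ∀ x, 0 ≤ ⟪x, S x⟫_ℂ)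
    (r : ℝ) (hr : 0 ≤ r) (a : A) : commutantFunctional ω S hS hpos r hr a =
      (r : ℂ) * ⟪gnsVector ω, S (ω.gnsStarAlgHom a (gnsVector ω))⟫_ℂ := rfl

/-- For small `ε` the operators `1/2 ± εT` are positive, lie in the commutant and add up to `1`, so
they split `ω` into two positive functionals. Purity makes each piece proportional to `ω`, which
forces `1/2 + εT`, and hence `T`, to be scalar. -/
lemma IsPureState.commutant_scalar_of_isSelfAdjoint {ω : A →ₚ[ℂ] ℂ} (hω : IsPureState ω)
    {T : ω.GNS →L[ℂ] ω.GNS} (hsa : IsSelfAdjoint T)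
    (hT : ∀ a, Commute T (ω.gnsStarAlgHom a)) :
    ∃ c : ℂ, T = c • (1 : ω.GNS →L[ℂ] ω.GNS) := by
  have hst : IsState ω := hω.1
  -- Small enough for `1/2 ± εT ≥ 1/4`; the `+ 1` keeps `ε` positive when `T = 0`.
  set ε : ℝ := (4 * (‖T‖ + 1))⁻¹ with hε
  have hε0 : 0 < ε := by positivity
  have hεT : ε * ‖T‖ ≤ 1 / 4 := by
    rw [hε, inv_mul_le_iff₀ (by positivity)]; linarith [norm_nonneg T]
  have hreal : ∀ x, ((⟪x, T x⟫_ℂ).re : ℂ) = ⟪x, T x⟫_ℂ := fun x => by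
    have h : (starRingEnd ℂ) ⟪x, T x⟫_ℂ = ⟪x, T x⟫_ℂ := by
      rw [inner_conj_symm]
      exact hsa.isSymmetric x x
    exact Complex.conj_eq_iff_re.1 h
  have hbound : ∀ x, |ε * (⟪x, T x⟫_ℂ).re| ≤ 1 / 4 * ‖x‖ ^ 2 := fun x => by
    rw [abs_mul, abs_of_pos hε0]
    calc ε * |(⟪x, T x⟫_ℂ).re| ≤ ε * (‖x‖ * (‖T‖ * ‖x‖)) := by
          gcongr
          exact (Complex.abs_re_le_norm _).trans ((norm_inner_le_norm _ _).trans
            (by gcongr; exact T.le_opNorm x))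
      _ = ε * ‖T‖ * ‖x‖ ^ 2 := by ring
      _ ≤ _ := by gcongr
  have key : ∀ δ : ℝ, |δ| = ε → ∃ S : ω.GNS →L[ℂ] ω.GNS,
      S = (1 / 2 : ℂ) • 1 + (δ : ℂ) • T ∧ (∀ a, Commute S (ω.gnsStarAlgHom a)) ∧
      (∀ x, 0 ≤ ⟪x, S x⟫_ℂ) ∧ 0 < (⟪gnsVector ω, S (gnsVector ω)⟫_ℂ).re ∧
      (((⟪gnsVector ω, S (gnsVector ω)⟫_ℂ).re : ℝ) : ℂ) =
        ⟪gnsVector ω, S (gnsVector ω)⟫_ℂ := by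
    intro δ hδ
    have hform : ∀ x, ⟪x, ((1 / 2 : ℂ) • (1 : ω.GNS →L[ℂ] ω.GNS) + (δ : ℂ) • T) x⟫_ℂ =
        ((1 / 2 * ‖x‖ ^ 2 + δ * (⟪x, T x⟫_ℂ).re : ℝ) : ℂ) := fun x => by
      have : ⟪x, x⟫_ℂ = ((‖x‖ : ℂ)) ^ 2 := inner_self_eq_norm_sq_to_K x
      simp only [add_apply, smul_apply, inner_add_right, inner_smul_right,
        one_apply_eq_self, this]
      push_cast
      rw [hreal]
    have hlow : ∀ x, 1 / 4 * ‖x‖ ^ 2 ≤ 1 / 2 * ‖x‖ ^ 2 + δ * (⟪x, T x⟫_ℂ).re := fun x => by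
      have h1 := hbound x
      rw [abs_mul, abs_of_pos hε0, ← hδ, ← abs_mul] at h1
      linarith [neg_abs_le (δ * (⟪x, T x⟫_ℂ).re)]
    refine ⟨_, rfl, fun a => ?_, fun x => ?_, ?_, ?_⟩
    · exact ((Commute.one_left _).smul_left _).add_left ((hT a).smul_left _)
    · rw [hform]
      exact Complex.zero_le_real.2 ((by positivity : (0 : ℝ) ≤ 1 / 4 * ‖x‖ ^ 2).trans (hlow x))
    · rw [hform, Complex.ofReal_re]
      have := hlow (gnsVector ω)
      rw [norm_gnsVector hst] at this ⊢
      linarith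
    · rw [hform, Complex.ofReal_re]
  obtain ⟨S, hSdef, hSc, hSp, hs0, hsr⟩ := key ε (abs_of_pos hε0)
  obtain ⟨S', hSdef', hSc', hSp', hs0', hsr'⟩ := key (-ε) (by rw [abs_neg, abs_of_pos hε0])
  set s := (⟪gnsVector ω, S (gnsVector ω)⟫_ℂ).re with hs
  set s' := (⟪gnsVector ω, S' (gnsVector ω)⟫_ℂ).re with hs'
  have hadd : ∀ x, S x + S' x = x := fun x => by
    rw [hSdef, hSdef']
    simp only [add_apply, smul_apply, one_apply_eq_self]
    push_cast
    module
  have hss : s + s' = 1 := by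
    rw [hs, hs', ← Complex.add_re, ← inner_add_right, hadd, inner_self_eq_norm_sq_to_K,
      norm_gnsVector hst]
    simp
  have hs1 : (1 - s) = s' := by linarith
  -- The weights `s` and `s' = 1 - s` are the masses of the two pieces, so dividing by them gives
  -- states with convex combination `ω`.
  obtain ⟨h1, -⟩ := hω.2 (commutantFunctional ω S hSc hSp s⁻¹ (by positivity)) (by
      change _ = _
      rw [commutantFunctional_apply, gnsStarAlgHom_one_gnsVector, ← hsr, ← Complex.ofReal_mul,
        inv_mul_cancel₀ hs0.ne', Complex.ofReal_one])
    (commutantFunctional ω S' hSc' hSp' s'⁻¹ (by positivity)) (by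
      change _ = _
      rw [commutantFunctional_apply, gnsStarAlgHom_one_gnsVector, ← hsr', ← Complex.ofReal_mul,
        inv_mul_cancel₀ hs0'.ne', Complex.ofReal_one])
    s hs0 (by linarith) (fun a => by
      rw [commutantFunctional_apply, commutantFunctional_apply, hs1, ← mul_assoc, ← mul_assoc,
        ← Complex.ofReal_mul, ← Complex.ofReal_mul, mul_inv_cancel₀ hs0.ne',
        mul_inv_cancel₀ hs0'.ne', Complex.ofReal_one, one_mul, one_mul, ← inner_add_right, hadd,
        ← eq_inner_gnsVector])
  -- Since `S` commutes with the algebra, the equality of functionals at `star a * b` is an equality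
  -- of matrix elements.
  have hS : S = (s : ℂ) • 1 := by
    refine gns_ext_inner fun a b => ?_
    have e := DFunLike.congr_fun h1 (star a * b)
    rw [commutantFunctional_apply, Complex.ofReal_inv, inv_mul_eq_iff_eq_mul₀
      (by exact_mod_cast hs0.ne'), map_mul, mul_apply_eq_comp] at e
    have e2 := DFunLike.congr_fun (hSc (star a)).eq (ω.gnsStarAlgHom b (gnsVector ω))
    simp only [mul_apply_eq_comp] at e2
    rw [e2, ← inner_gnsStarAlgHom_left] at e
    rw [e, smul_apply, one_apply_eq_self, inner_smul_right, inner_gns]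
  refine ⟨((s - 1 / 2) / ε : ℝ), ?_⟩
  have hεc : (ε : ℂ) ≠ 0 := by exact_mod_cast hε0.ne'
  have : (ε : ℂ) • T = ((s : ℂ) - 1 / 2) • (1 : ω.GNS →L[ℂ] ω.GNS) := by
    rw [sub_smul, ← hS, hSdef]; abel
  rw [← inv_smul_smul₀ hεc T, this, smul_smul]
  congr 1
  push_cast
  field_simp

/-- A pure state is a factor state. -/
lemma IsPureState.isFactorState {ω : A →ₚ[ℂ] ℂ} (hω : IsPureState ω) : IsFactorState ω := by
  refine ⟨hω.1, fun T hT => ?_⟩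
  have hT := (mem_gnsCenter_iff.1 hT).2
  have hT' : ∀ a, Commute (star T) (ω.gnsStarAlgHom a) := fun a => by
    have := (hT (star a)).star_star
    rwa [map_star, star_star] at this
  obtain ⟨c, hc⟩ := hω.commutant_scalar_of_isSelfAdjoint (T := T + star T)
    (IsSelfAdjoint.add_star_self T) fun a => (hT a).add_left (hT' a)
  obtain ⟨d, hd⟩ := hω.commutant_scalar_of_isSelfAdjoint
    (T := Complex.I • (T - star T)) (by
      rw [IsSelfAdjoint, star_smul, star_sub, star_star]
      simp [smul_sub, neg_add_eq_sub]) fun a => ((hT a).sub_left (hT' a)).smul_left _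
  refine ⟨(c - Complex.I * d) / 2, ?_⟩
  have h2 : (2 : ℂ) • T = (c - Complex.I * d) • (1 : ω.GNS →L[ℂ] ω.GNS) := by
    rw [sub_smul, ← hc, mul_smul, ← hd, smul_smul, Complex.I_mul_I]
    module
  rw [div_eq_inv_mul, mul_smul, ← h2, inv_smul_smul₀ two_ne_zero]

end GNS

/-! ### Weak operator limits along ultrafilters -/

/-- A bounded family of operators on a Hilbert space has a weak limit along every ultrafilter. -/
lemma exists_weak_limit {H ι : Type*} [NormedAddCommGroup H] [InnerProductSpace ℂ H]
    [CompleteSpace H] (U : Ultrafilter ι) (T : ι → H →L[ℂ] H) {C : ℝ} (hC : ∀ i, ‖T i‖ ≤ C) :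
    ∃ S : H →L[ℂ] H, ∀ x y, Tendsto (fun i => ⟪x, T i y⟫_ℂ) U (𝓝 ⟪x, S y⟫_ℂ) := by
  have hbd : ∀ x y i, ‖⟪T i x, y⟫_ℂ‖ ≤ C * ‖x‖ * ‖y‖ := fun x y i =>
    (norm_inner_le_norm _ _).trans (by gcongr; exact (T i).le_of_opNorm_le (hC i) x)
  have hlim : ∀ x y, ∃ z : ℂ, ‖z‖ ≤ C * ‖x‖ * ‖y‖ ∧
      Tendsto (fun i => ⟪T i x, y⟫_ℂ) U (𝓝 z) := fun x y => by
    obtain ⟨z, hz, hU⟩ := (isCompact_closedBall (0 : ℂ) (C * ‖x‖ * ‖y‖)).ultrafilter_le_nhds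
      (U.map fun i => ⟪T i x, y⟫_ℂ)
      (le_principal_iff.2 (Ultrafilter.mem_map.2
        (Eventually.of_forall fun i => by simpa using hbd x y i)))
    exact ⟨z, by simpa using hz, hU⟩
  choose F hF hFlim using hlim
  -- The limits exist by compactness of discs; their uniqueness makes `F` sesquilinear, and the
  -- bound survives, so `F` is the form of a bounded operator.
  let B : H →L⋆[ℂ] H →L[ℂ] ℂ := LinearMap.mkContinuous₂
    (LinearMap.mk₂'ₛₗ (starRingEnd ℂ) (RingHom.id ℂ) F
      (fun x x' y => tendsto_nhds_unique (hFlim _ _) (by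
        simpa only [map_add, inner_add_left] using (hFlim x y).add (hFlim x' y)))
      (fun c x y => tendsto_nhds_unique (hFlim _ _) (by
        simpa only [map_smul, inner_smul_left, smul_eq_mul] using (hFlim x y).const_mul _))
      (fun x y y' => tendsto_nhds_unique (hFlim _ _) (by
        simpa only [inner_add_right] using (hFlim x y).add (hFlim x y')))
      (fun c x y => tendsto_nhds_unique (hFlim _ _) (by
        simpa only [inner_smul_right, smul_eq_mul, RingHom.id_apply] using (hFlim x y).const_mul _))) C hF
  refine ⟨InnerProductSpace.continuousLinearMapOfBilin B, fun x y => ?_⟩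
  rw [← inner_conj_symm, InnerProductSpace.continuousLinearMapOfBilin_apply]
  have h := (Complex.continuous_conj.tendsto _).comp (hFlim y x)
  refine h.congr fun i => ?_
  rw [Function.comp_apply, inner_conj_symm]

/-! ### Space-like geometry of translations and boosts -/

namespace Spacetime

variable {ν : ℕ}

/-- Bounded regions become space-like separated when one of them is translated to infinity away
from the light cone. -/
lemma eventually_spacelikeSeparated {ι : Type*} {l : Filter ι} {p : ι → Spacetime ν}
    (hp : Tendsto (fun i => ‖(p i).2‖ - |(p i).1|) l atTop) {O₁ O₂ : Set (Spacetime ν)}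
    (h₁ : Bornology.IsBounded O₁) (h₂ : Bornology.IsBounded O₂) :
    ∀ᶠ i in l, SpacelikeSeparated O₁
      ((translation (p i) : Spacetime ν ≃ᵃ[ℝ] Spacetime ν) '' O₂) := by
  obtain ⟨R₁, hR₁⟩ := h₁.exists_norm_le
  obtain ⟨R₂, hR₂⟩ := h₂.exists_norm_le
  -- The difference of two points of the regions moves the time and the space component by at most
  -- `R₁ + R₂` each.
  filter_upwards [hp.eventually_gt_atTop (2 * (R₁ + R₂))] with i hi
  rintro q₁ hq₁ _ ⟨q₂, hq₂, rfl⟩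
  change minkowskiSq (q₁ - (p i + q₂)) < 0
  have e : q₁ - (p i + q₂) = (q₁ - q₂) - p i := by abel
  have hd : ‖q₁ - q₂‖ ≤ R₁ + R₂ :=
    (norm_sub_le _ _).trans (add_le_add (hR₁ _ hq₁) (hR₂ _ hq₂))
  rw [e]
  set d := q₁ - q₂
  have hd1 : |d.1| ≤ R₁ + R₂ := (norm_fst_le d).trans hd
  have hd2 : ‖d.2‖ ≤ R₁ + R₂ := (norm_snd_le d).trans hd
  have h1 : |d.1 - (p i).1| ≤ |d.1| + |(p i).1| := abs_sub _ _
  have h2 : ‖(p i).2‖ - ‖d.2‖ ≤ ‖d.2 - (p i).2‖ := by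
    rw [norm_sub_rev]; exact norm_sub_norm_le _ _
  have h3 : |d.1 - (p i).1| < ‖d.2 - (p i).2‖ := by linarith
  unfold minkowskiSq
  have h4 : (d.1 - (p i).1) ^ 2 < ‖d.2 - (p i).2‖ ^ 2 := by
    rw [← sq_abs (d.1 - (p i).1)]
    gcongr
  simpa using sub_neg.2 h4

lemma translation_add (p q : Spacetime ν) :
    (translation (p + q) : poincareGroup ν) = translation p * translation q :=
  Subtype.ext (AffineEquiv.ext fun r => add_assoc p q r)

variable [NeZero ν]

lemma tendsto_norm_space (ν : ℕ) [NeZero ν] :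
    Tendsto (fun x : EuclideanSpace ℝ (Fin ν) =>
      ‖((0, x) : Spacetime ν).2‖ - |((0, x) : Spacetime ν).1|)
      (cocompact (EuclideanSpace ℝ (Fin ν))) atTop := by
  simpa using tendsto_norm_cocompact_atTop (E := EuclideanSpace ℝ (Fin ν))

/-- The difference of two distinct unit time-like vectors on the same boost orbit is space-like. -/
lemma tendsto_norm_boost_sub {v w : ℝ} (h : v ≠ w) :
    Tendsto (fun t : ℝ => ‖(boostFun w (t, 0) - boostFun v (t, 0) : Spacetime ν).2‖ -
      |(boostFun w (t, 0) - boostFun v (t, 0) : Spacetime ν).1|) atTop atTop := by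
  -- The difference of the squares is `2 (cosh (w - v) - 1)`, which is positive for `v ≠ w`.
  have hpos : 0 < |Real.sinh w - Real.sinh v| - |Real.cosh w - Real.cosh v| := by
    rw [sub_pos]
    apply sq_lt_sq.1
    have h1 : 1 < Real.cosh (w - v) := Real.one_lt_cosh.2 (sub_ne_zero.2 h.symm)
    rw [Real.cosh_sub] at h1
    nlinarith [Real.cosh_sq v, Real.cosh_sq w]
  refine (tendsto_id.atTop_mul_const hpos).congr' ?_
  filter_upwards [eventually_ge_atTop 0] with t ht
  have e1 : (boostFun w (t, 0) - boostFun v (t, 0) : Spacetime ν).1 =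
      t * (Real.cosh w - Real.cosh v) := by
    simp [boostFun]; ring
  have e2 : (boostFun w (t, 0) - boostFun v (t, 0) : Spacetime ν).2 =
      (-(t * (Real.sinh w - Real.sinh v))) • e₁ := by
    simp only [boostFun, Prod.snd_sub, PiLp.zero_apply]
    module
  rw [e1, e2, norm_smul, abs_mul, norm_neg, Real.norm_eq_abs, abs_mul, abs_of_nonneg ht]
  simp [e₁]
  ring

/-- Linearity of the boost. It makes boosted states translation invariant, and turns time evolution
seen from a moving frame into translation along a tilted time axis. -/
lemma boost_mul_translation (v : ℝ) (p : Spacetime ν) :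
    (boost v * translation p : poincareGroup ν) = translation (boostFun v p) * boost v :=
  Subtype.ext (AffineEquiv.ext fun q => (boostLin v).map_add p q)

end Spacetime

/-! ### Asymptotic abelianness, clustering and extremality -/

namespace HaagKastlerNet

open Spacetime

variable {ν : ℕ} {A : Type*} [CStarAlgebra A]

lemma norm_act (N : HaagKastlerNet ν A) (g : poincareGroup ν) (a : A) : ‖N.act g a‖ = ‖a‖ :=
  NonUnitalStarAlgHom.norm_map (N.act g) (N.act g).injective a

lemma ξ_add (N : HaagKastlerNet ν A) (p q : Spacetime ν) (a : A) :
    N.ξ (p + q) a = N.ξ p (N.ξ q a) := by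
  simp only [ξ, translation_add, map_mul]
  rfl

lemma boostAut_ξ [NeZero ν] (N : HaagKastlerNet ν A) (v : ℝ) (p : Spacetime ν) (a : A) :
    N.boostAut v (N.ξ p a) = N.ξ (boostFun v p) (N.boostAut v a) := by
  have h := congrArg N.act (boost_mul_translation v p)
  rw [map_mul, map_mul] at h
  exact DFunLike.congr_fun h a

/-- Asymptotic abelianness in space-like directions. -/
lemma tendsto_norm_commutator (N : HaagKastlerNet ν A) {ι : Type*} {l : Filter ι}
    {p : ι → Spacetime ν} (hp : Tendsto (fun i => ‖(p i).2‖ - |(p i).1|) l atTop) (a b : A) :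
    Tendsto (fun i => ‖a * N.ξ (p i) b - N.ξ (p i) b * a‖) l (𝓝 0) := by
  rw [NormedAddGroup.tendsto_nhds_zero]
  intro ε hε
  have approx : ∀ (a : A) (K : ℝ), 0 ≤ K → ∃ a', (∃ O, IsOpen O ∧ Bornology.IsBounded O ∧
      a' ∈ N.localAlg O) ∧ 2 * ‖a - a'‖ * K < ε / 2 := by
    intro a K hK
    obtain ⟨a', ha', hd⟩ := N.quasilocal.exists_dist_lt a
      (show 0 < ε / (4 * (K + 1)) by positivity)
    refine ⟨a', ha', ?_⟩
    rw [dist_eq_norm, lt_div_iff₀ (by positivity)] at hd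
    nlinarith [norm_nonneg (a - a')]
  -- `a'` is chosen before `b'`, because the tolerance for `b'` involves `‖a'‖`.
  obtain ⟨a', ⟨O₁, ho₁, hb₁, ha'⟩, hna⟩ := approx a ‖b‖ (norm_nonneg _)
  obtain ⟨b', ⟨O₂, ho₂, hb₂, hb'⟩, hnb⟩ := approx b ‖a'‖ (norm_nonneg _)
  filter_upwards [eventually_spacelikeSeparated hp hb₁ hb₂] with i hi
  have hmem : N.ξ (p i) b' ∈ N.localAlg
      ((translation (p i) : Spacetime ν ≃ᵃ[ℝ] Spacetime ν) '' O₂) := by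
    rw [← SetLike.mem_coe, N.covariance _ _ ho₂ hb₂]
    exact ⟨b', hb', rfl⟩
  have him : ((translation (p i) : Spacetime ν ≃ᵃ[ℝ] Spacetime ν) '' O₂) =
      (fun q => p i + q) '' O₂ := rfl
  have hcomm : a' * N.ξ (p i) b' = N.ξ (p i) b' * a' := by
    refine N.locality _ _ ho₁ hb₁ ?_ ?_ hi _ ha' _ hmem
    · rw [him]
      exact (Homeomorph.addLeft (p i)).isOpenMap _ ho₂
    · rw [him]
      exact hb₂.vadd (p i)
  have e : a * N.ξ (p i) b - N.ξ (p i) b * a =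
      ((a - a') * N.ξ (p i) b - N.ξ (p i) b * (a - a')) +
      (a' * N.ξ (p i) (b - b') - N.ξ (p i) (b - b') * a') := by
    rw [map_sub]
    linear_combination (norm := noncomm_ring) hcomm
  have hc : ∀ x y : A, ‖x * N.ξ (p i) y - N.ξ (p i) y * x‖ ≤ 2 * ‖x‖ * ‖y‖ := fun x y => by
    have hn : ‖N.ξ (p i) y‖ = ‖y‖ := N.norm_act _ y
    calc _ ≤ ‖x * N.ξ (p i) y‖ + ‖N.ξ (p i) y * x‖ := norm_sub_le _ _
      _ ≤ ‖x‖ * ‖N.ξ (p i) y‖ + ‖N.ξ (p i) y‖ * ‖x‖ :=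
        add_le_add (norm_mul_le _ _) (norm_mul_le _ _)
      _ = _ := by rw [hn]; ring
  rw [norm_norm, e]
  calc _ ≤ 2 * ‖a - a'‖ * ‖b‖ + 2 * ‖a'‖ * ‖b - b'‖ :=
        (norm_add_le _ _).trans (add_le_add (hc _ _) (hc _ _))
    _ = 2 * ‖a - a'‖ * ‖b‖ + 2 * ‖b - b'‖ * ‖a'‖ := by ring
    _ < ε := by linarith

variable [PartialOrder A] [StarOrderedRing A]

/-- Weak limits of observables translated to space-like infinity are central. -/
lemma exists_mem_gnsCenter_tendsto (N : HaagKastlerNet ν A) (ω : A →ₚ[ℂ] ℂ) {ι : Type*}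
    {U : Ultrafilter ι} {p : ι → Spacetime ν}
    (hp : Tendsto (fun i => ‖(p i).2‖ - |(p i).1|) U atTop) (b : A) :
    ∃ T ∈ gnsCenter ω, ∀ x y,
      Tendsto (fun i => ⟪x, ω.gnsStarAlgHom (N.ξ (p i) b) y⟫_ℂ) U (𝓝 ⟪x, T y⟫_ℂ) := by
  obtain ⟨T, hT⟩ := exists_weak_limit U (fun i => ω.gnsStarAlgHom (N.ξ (p i) b)) (C := ‖b‖)
    fun i => (norm_gnsStarAlgHom_le ω _).trans_eq (N.norm_act _ b)
  refine ⟨T, mem_gnsCenter_iff.2 ⟨fun S hS => ?_, fun a => ?_⟩, hT⟩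
  -- Each translate commutes exactly with the commutant, and this passes to the weak limit; against
  -- the algebra itself, below, the commutator only vanishes in the limit.
  · refine ContinuousLinearMap.ext fun y => ext_inner_left ℂ fun x => ?_
    rw [mul_apply_eq_comp, mul_apply_eq_comp, ← ContinuousLinearMap.adjoint_inner_left S]
    have h2 := hT (ContinuousLinearMap.adjoint S x) y
    refine tendsto_nhds_unique (hT x (S y)) (h2.congr fun i => ?_)
    rw [ContinuousLinearMap.adjoint_inner_left]
    have e := DFunLike.congr_fun (hS (N.ξ (p i) b)).eq y
    rw [mul_apply_eq_comp, mul_apply_eq_comp] at e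
    rw [e]
  · refine ContinuousLinearMap.ext fun y => ext_inner_left ℂ fun x => ?_
    rw [mul_apply_eq_comp, mul_apply_eq_comp,
      ← ContinuousLinearMap.adjoint_inner_left (ω.gnsStarAlgHom a)]
    have h1 := hT x (ω.gnsStarAlgHom a y)
    have h2 := hT (ContinuousLinearMap.adjoint (ω.gnsStarAlgHom a) x) y
    rw [← sub_eq_zero]
    refine tendsto_nhds_unique (h1.sub h2) (squeeze_zero_norm (a := fun i =>
      ‖x‖ * (‖a * N.ξ (p i) b - N.ξ (p i) b * a‖ * ‖y‖)) (fun i => ?_) ?_)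
    · rw [ContinuousLinearMap.adjoint_inner_left, ← inner_sub_right, ← mul_apply_eq_comp,
        ← mul_apply_eq_comp, ← map_mul, ← map_mul, ← sub_apply, ← map_sub]
      refine (norm_inner_le_norm _ _).trans ?_
      gcongr
      rw [norm_sub_rev (a * _)]
      exact ContinuousLinearMap.le_of_opNorm_le _ (norm_gnsStarAlgHom_le ω _) _
    · simpa using ((N.tendsto_norm_commutator hp a b).mul_const ‖y‖).const_mul ‖x‖

variable {N : HaagKastlerNet ν A} {ω : A →ₚ[ℂ] ℂ}

/-- In a translation invariant factor state, observables translated to space-like infinity converge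
weakly to their expectation. -/
lemma tendsto_inner_of_isFactorState (hω : IsFactorState ω) (hinv : N.IsTranslationInvariant ω)
    {ι : Type*} {l : Filter ι} {p : ι → Spacetime ν}
    (hp : Tendsto (fun i => ‖(p i).2‖ - |(p i).1|) l atTop) (b : A) (x y : ω.GNS) :
    Tendsto (fun i => ⟪x, ω.gnsStarAlgHom (N.ξ (p i) b) y⟫_ℂ) l (𝓝 (ω b * ⟪x, y⟫_ℂ)) := by
  -- Along every ultrafilter the weak limit is the same scalar `ω b`, so the original filter
  -- converges.
  rw [tendsto_iff_ultrafilter]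
  intro U hU
  obtain ⟨T, hT, hlim⟩ := N.exists_mem_gnsCenter_tendsto ω (hp.mono_left hU) b
  obtain ⟨c, rfl⟩ := hω.2 T hT
  have hc : c = ω b := by
    have h := hlim (gnsVector ω) (gnsVector ω)
    simp only [← eq_inner_gnsVector, hinv (p _) b, smul_apply, one_apply_eq_self,
      inner_smul_right, inner_self_eq_norm_sq_to_K, norm_gnsVector hω.1] at h
    simpa using (tendsto_nhds_unique h tendsto_const_nhds)
  simpa [inner_smul_right, hc] using hlim x y

/-- Clustering of translation invariant factor states in space-like directions. -/
lemma tendsto_apply_mul_of_isFactorState (hω : IsFactorState ω)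
    (hinv : N.IsTranslationInvariant ω) {ι : Type*} {l : Filter ι} {p : ι → Spacetime ν}
    (hp : Tendsto (fun i => ‖(p i).2‖ - |(p i).1|) l atTop) (a b : A) :
    Tendsto (fun i => ω (a * N.ξ (p i) b)) l (𝓝 (ω a * ω b)) := by
  have h := tendsto_inner_of_isFactorState hω hinv hp b
    (ω.gnsStarAlgHom (star a) (gnsVector ω)) (gnsVector ω)
  simp only [inner_gns, star_star] at h
  rw [inner_gnsStarAlgHom_left, star_star, ← eq_inner_gnsVector, mul_comm] at h
  exact h

variable [NeZero ν]

/-- Domination makes `φ` a vector functional `⟪η, π_ω(a)Ω⟫` on the GNS space of `ω`. Weak clustering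
then sends `φ(σ_x b)` to `ω(b) φ(1) = ω(b)`, while invariance keeps it equal to `φ(b)`. -/
lemma eq_of_dominated (hω : IsFactorState ω) (hinv : N.IsTranslationInvariant ω)
    {φ : A →ₚ[ℂ] ℂ} (hφ : IsState φ) (hφinv : N.IsSpaceInvariant φ) {C : ℝ}
    (h : ∀ a, (φ (star a * a)).re ≤ C * (ω (star a * a)).re) : φ = ω := by
  set W := gnsMap ω φ (StarAlgEquiv.refl ℂ A) C h
  have hW : ∀ a, ⟪ContinuousLinearMap.adjoint W (gnsVector φ),
      ω.gnsStarAlgHom a (gnsVector ω)⟫_ℂ = φ a := fun a => by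
    have e : W (ω.gnsStarAlgHom a (gnsVector ω)) = φ.gnsStarAlgHom a (gnsVector φ) :=
      gnsMap_apply (γ := StarAlgEquiv.refl ℂ A) h a
    rw [ContinuousLinearMap.adjoint_inner_left, e, ← eq_inner_gnsVector]
  refine PositiveLinearMap.ext fun b => ?_
  have hlim := tendsto_inner_of_isFactorState hω hinv (tendsto_norm_space ν) b
    (ContinuousLinearMap.adjoint W (gnsVector φ)) (gnsVector ω)
  rw [← gnsStarAlgHom_one_gnsVector ω, hW, hφ, mul_one] at hlim
  simp only [gnsStarAlgHom_one_gnsVector, hW] at hlim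
  exact tendsto_nhds_unique (tendsto_const_nhds.congr fun x => (hφinv x b).symm) hlim

/-- A translation invariant factor state is extremal among the space-translation invariant
states. -/
lemma isExtremalSpaceInvariant_of_isFactorState (hω : IsFactorState ω)
    (hinv : N.IsTranslationInvariant ω) : N.IsExtremalSpaceInvariant ω := by
  refine ⟨⟨hω.1, fun x => hinv (0, x)⟩, fun φ hφ ψ hψ s hs0 hs1 h => ?_⟩
  have hre : ∀ (χ : A →ₚ[ℂ] ℂ) a, 0 ≤ (χ (star a * a)).re := fun χ a =>
    (Complex.nonneg_iff.1 (χ.map_nonneg (star_mul_self_nonneg a))).1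
  have h' : ∀ a, (ω (star a * a)).re =
      s * (φ (star a * a)).re + (1 - s) * (ψ (star a * a)).re := fun a => by
    rw [h, Complex.add_re, Complex.re_ofReal_mul, Complex.re_ofReal_mul]
  constructor
  · refine eq_of_dominated hω hinv hφ.1 hφ.2 (C := s⁻¹) fun a => ?_
    rw [h', le_inv_mul_iff₀ hs0]
    nlinarith [hre ψ a]
  · refine eq_of_dominated hω hinv hψ.1 hψ.2 (C := (1 - s)⁻¹) fun a => ?_
    rw [h', le_inv_mul_iff₀ (by linarith)]
    nlinarith [hre φ a]

lemma IsTranslationInvariant.boosted (hinv : N.IsTranslationInvariant ω) (v : ℝ) :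
    N.IsTranslationInvariant (N.boosted ω v) := fun p a => by
  rw [HaagKastlerNet.boosted, pullback_apply, pullback_apply, boostAut_ξ, hinv]

end HaagKastlerNet

/-! ### Averages of asymptotically orthogonal vectors -/

section Hilbert

variable {H : Type*} [NormedAddCommGroup H] [InnerProductSpace ℂ H]
  {u : ℝ → ℝ → H} {C : ℝ}

lemma Integrable.inner_of_bound {h w : ℝ → H} (hh : Integrable h) (hw : Continuous w)
    (hC : ∀ v, ‖w v‖ ≤ C) : Integrable fun v => ⟪h v, w v⟫_ℂ := by
  refine (hh.norm.mul_const C).mono' (hh.aestronglyMeasurable.inner hw.aestronglyMeasurable)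
    (Eventually.of_forall fun v => (norm_inner_le_norm _ _).trans ?_)
  gcongr
  exact hC v

variable [CompleteSpace H]

/-- Averages over a set of finite measure of bounded families of vectors that become pairwise
orthogonal tend to zero. -/
lemma tendsto_setIntegral_zero_of_asymptotically_orthogonal (hu : ∀ t, Continuous (u t))
    (hC : ∀ t v, ‖u t v‖ ≤ C)
    (horth : ∀ v w, v ≠ w → Tendsto (fun t => ⟪u t v, u t w⟫_ℂ) atTop (𝓝 0))
    {s : Set ℝ} (hs : volume s < ⊤) :
    Tendsto (fun t => ∫ v in s, u t v) atTop (𝓝 0) := by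
  have : IsFiniteMeasure (volume.restrict s) := ⟨by simpa using hs⟩
  have hC0 : 0 ≤ C := (norm_nonneg _).trans (hC 0 0)
  have hint : ∀ t, Integrable (u t) (volume.restrict s) := fun t =>
    Integrable.of_bound (hu t).aestronglyMeasurable C (Eventually.of_forall (hC t))
  have h1 : ∀ w, Tendsto (fun t => ⟪u t w, ∫ v in s, u t v⟫_ℂ) atTop (𝓝 0) := fun w => by
    simp only [← integral_inner (hint _)]
    rw [← integral_zero ℝ ℂ (μ := volume.restrict s)]
    refine tendsto_integral_filter_of_dominated_convergence (fun _ => C * C)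
      (Eventually.of_forall fun t => (continuous_const.inner (hu t)).aestronglyMeasurable)
      (Eventually.of_forall fun t => Eventually.of_forall fun v =>
        (norm_inner_le_norm _ _).trans ?_) (integrable_const _) ?_
    · exact mul_le_mul (hC _ _) (hC _ _) (norm_nonneg _) hC0
    -- Orthogonality fails only on the diagonal, which is Lebesgue null.
    · have hne : ∀ᵐ v ∂(volume.restrict s), v ≠ w := ae_restrict_of_ae (by simp [ae_iff])
      filter_upwards [hne] with v hv
      exact horth w v hv.symm
  -- The squared norm of the average is the integral over `w` of the pairings treated in `h1`.
  have h2 : Tendsto (fun t => ⟪∫ v in s, u t v, ∫ v in s, u t v⟫_ℂ) atTop (𝓝 0) := by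
    simp only [← integral_inner (hint _)]
    rw [← integral_zero ℝ ℂ (μ := volume.restrict s)]
    refine tendsto_integral_filter_of_dominated_convergence
      (fun _ => C * (volume.restrict s).real Set.univ * C)
      (Eventually.of_forall fun t => (continuous_const.inner (hu t)).aestronglyMeasurable)
      (Eventually.of_forall fun t => Eventually.of_forall fun v =>
        (norm_inner_le_norm _ _).trans ?_) (integrable_const _) (Eventually.of_forall fun w => ?_)
    · gcongr
      · exact norm_integral_le_of_norm_le_const (Eventually.of_forall (hC t))
      · exact hC _ _
    · refine tendsto_zero_iff_norm_tendsto_zero.2 ?_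
      simp only [norm_inner_symm (∫ v in s, u _ v)]
      exact tendsto_zero_iff_norm_tendsto_zero.1 (h1 w)
  rw [tendsto_zero_iff_norm_tendsto_zero] at h2 ⊢
  have h3 := h2.sqrt
  simp only [inner_self_eq_norm_sq_to_K, norm_pow, RCLike.norm_ofReal, abs_norm,
    Real.sqrt_sq (norm_nonneg _), Real.sqrt_zero] at h3
  exact h3

/-- Bounded families of vectors that become pairwise orthogonal tend weakly to zero when
integrated against a vector-valued integrable function. -/
lemma tendsto_integral_inner_zero_of_asymptotically_orthogonal (hu : ∀ t, Continuous (u t))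
    (hC : ∀ t v, ‖u t v‖ ≤ C)
    (horth : ∀ v w, v ≠ w → Tendsto (fun t => ⟪u t v, u t w⟫_ℂ) atTop (𝓝 0))
    {h : ℝ → H} (hh : Integrable h) :
    Tendsto (fun t => ∫ v, ⟪h v, u t v⟫_ℂ) atTop (𝓝 0) := by
  have hC0 : 0 ≤ C := (norm_nonneg _).trans (hC 0 0)
  refine Integrable.induction
    (fun h => Tendsto (fun t => ∫ v, ⟪h v, u t v⟫_ℂ) atTop (𝓝 0)) ?_ ?_ ?_ ?_ hh
  · intro c s hs hfin
    have : IsFiniteMeasure (volume.restrict s) := ⟨by simpa using hfin⟩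
    have e : ∀ t, ∫ v, ⟪s.indicator (fun _ => c) v, u t v⟫_ℂ = ⟪c, ∫ v in s, u t v⟫_ℂ := by
      intro t
      rw [← integral_inner (Integrable.of_bound (hu t).aestronglyMeasurable C
        (Eventually.of_forall (hC t))), ← integral_indicator hs]
      congr 1 with v
      by_cases hv : v ∈ s <;> simp [hv]
    simp only [e]
    simpa using (tendsto_const_nhds (x := c)).inner (𝕜 := ℂ)
      (tendsto_setIntegral_zero_of_asymptotically_orthogonal hu hC horth hfin)
  · intro f g _ hf hg hPf hPg
    have e : ∀ t, ∫ v, ⟪(f + g) v, u t v⟫_ℂ =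
        (∫ v, ⟪f v, u t v⟫_ℂ) + ∫ v, ⟪g v, u t v⟫_ℂ := fun t => by
      simp only [Pi.add_apply, inner_add_left]
      exact integral_add (Integrable.inner_of_bound hf (hu t) (hC t))
        (Integrable.inner_of_bound hg (hu t) (hC t))
    simp only [e]
    simpa using hPf.add hPg
  -- The integral is `C`-Lipschitz in the `L¹` norm uniformly in `t`, so convergence passes to `L¹`
  -- limits.
  · refine isClosed_of_closure_subset fun f hf => ?_
    rw [Set.mem_ofPred_eq, NormedAddGroup.tendsto_nhds_zero]
    intro ε hε
    obtain ⟨g, hg, hd⟩ := Metric.mem_closure_iff.1 hf (ε / (2 * (C + 1))) (by positivity)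
    filter_upwards [NormedAddGroup.tendsto_nhds_zero.1 hg (ε / 2) (by positivity)] with t ht
    have hfi := Integrable.inner_of_bound (L1.integrable_coeFn f) (hu t) (hC t)
    have hgi := Integrable.inner_of_bound (L1.integrable_coeFn g) (hu t) (hC t)
    have hsub : ‖(∫ v, ⟪f v, u t v⟫_ℂ) - ∫ v, ⟪g v, u t v⟫_ℂ‖ ≤ C * ‖f - g‖ := by
      rw [← integral_sub hfi hgi, L1.norm_eq_integral_norm, ← integral_const_mul]
      refine norm_integral_le_of_norm_le ((L1.integrable_coeFn (f - g)).norm.const_mul C) ?_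
      filter_upwards [Lp.coeFn_sub f g] with v hv
      rw [hv, ← inner_sub_left, Pi.sub_apply, mul_comm]
      exact (norm_inner_le_norm _ _).trans (by gcongr; exact hC _ _)
    rw [dist_eq_norm, lt_div_iff₀ (by positivity)] at hd
    have h1 : C * ‖f - g‖ ≤ ε / 2 := by nlinarith [norm_nonneg (f - g)]
    calc ‖∫ v, ⟪f v, u t v⟫_ℂ‖ ≤ ‖∫ v, ⟪g v, u t v⟫_ℂ‖ +
          ‖(∫ v, ⟪f v, u t v⟫_ℂ) - ∫ v, ⟪g v, u t v⟫_ℂ‖ := norm_le_norm_add_norm_sub' _ _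
      _ < ε := by linarith
  · intro f g hfg _ hPf
    refine hPf.congr fun t => integral_congr_ae ?_
    filter_upwards [hfg] with v hv
    rw [hv]

end Hilbert

/-- Dominated convergence as `|x| → ∞` requires a countably generated filter. -/
lemma isCountablyGenerated_cocompact {E : Type*} [NormedAddCommGroup E] [ProperSpace E] :
    (cocompact E).IsCountablyGenerated := by
  rw [← Metric.cobounded_eq_cocompact, ← comap_norm_atTop]
  infer_instance

/-! ### Operators fixed by the extended automorphisms -/

section GNS

variable {A : Type*} [CStarAlgebra A] [PartialOrder A] [StarOrderedRing A] {ω : A →ₚ[ℂ] ℂ}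

lemma gnsUnitary_gns (γ : A ≃⋆ₐ[ℂ] A) (h : ∀ a, ω (γ a) = ω a) (a : A) :
    (gnsUnitary ω γ h : ω.GNS →L[ℂ] ω.GNS) (ω.gnsStarAlgHom a (gnsVector ω)) =
      ω.gnsStarAlgHom (γ a) (gnsVector ω) := by
  rw [gnsStarAlgHom_gnsVector, gnsUnitary_apply_coe, gnsStarAlgHom_gnsVector,
    PositiveLinearMap.ofPreGNS_toPreGNS]

/-- An operator with `γ`-invariant matrix elements is fixed by the extension of `γ`. -/
lemma gnsAut_eq_self {γ : A ≃⋆ₐ[ℂ] A} (h : ∀ a, ω (γ a) = ω a) {T : ω.GNS →L[ℂ] ω.GNS}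
    (hT : ∀ a b, ⟪ω.gnsStarAlgHom (γ a) (gnsVector ω),
        T (ω.gnsStarAlgHom (γ b) (gnsVector ω))⟫_ℂ =
      ⟪ω.gnsStarAlgHom a (gnsVector ω), T (ω.gnsStarAlgHom b (gnsVector ω))⟫_ℂ) :
    gnsAut ω γ h T = T := by
  have key : (gnsUnitary ω γ h : ω.GNS →L[ℂ] ω.GNS) * T =
      T * (gnsUnitary ω γ h : ω.GNS →L[ℂ] ω.GNS) := by
    refine gns_ext_inner fun a b => ?_
    -- Writing the left vector as a `γ`-image lets `hT` remove `γ` from both sides, after which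
    -- unitarity restores it.
    obtain ⟨a, rfl⟩ : ∃ a', γ a' = a := γ.surjective a
    rw [mul_apply_eq_comp, mul_apply_eq_comp, gnsUnitary_gns, hT, ← gnsUnitary_gns γ h a,
      ContinuousLinearMap.inner_map_map_of_mem_unitary (gnsUnitary ω γ h).2]
  rw [gnsAut, Unitary.conjStarAlgAut_apply, key, mul_assoc, Unitary.mul_star_self_of_mem
    (gnsUnitary ω γ h).2, mul_one]

lemma gnsExt_gnsStarAlgHom_mul (a : A) (T : ω.GNS →L[ℂ] ω.GNS) :
    gnsExt ω (ω.gnsStarAlgHom a * T) =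
      ⟪ω.gnsStarAlgHom (star a) (gnsVector ω), T (gnsVector ω)⟫_ℂ := by
  rw [gnsExt, mul_apply_eq_comp, inner_gnsStarAlgHom_left, star_star]

end GNS

/-! ### The smeared state: space and time limits, boost invariance, the central element -/

namespace HaagKastlerNet

open Spacetime

variable {ν : ℕ} [NeZero ν] {A : Type*} [CStarAlgebra A] [PartialOrder A] [StarOrderedRing A]
  {N : HaagKastlerNet ν A} {ω : A →ₚ[ℂ] ℂ}

lemma boosted_apply (N : HaagKastlerNet ν A) (ω : A →ₚ[ℂ] ℂ) (v : ℝ) (a : A) :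
    N.boosted ω v a = ω (N.boostAut v a) := rfl

lemma smeared_apply (h : N.ContinuousBoosts) (ω : A →ₚ[ℂ] ℂ) (f : SmearingFunction) (a : A) :
    N.smeared h ω f a = ∫ v, (f.toFun v : ℂ) * N.boosted ω v a := rfl

lemma isState_boosted (hω : IsState ω) (v : ℝ) : IsState (N.boosted ω v) := by
  rw [IsState, boosted_apply, map_one, hω]

lemma isState_smeared (h : N.ContinuousBoosts) (hω : IsState ω) (f : SmearingFunction) :
    IsState (N.smeared h ω f) := by
  have e : ∀ v, N.boosted ω v 1 = 1 := fun v => isState_boosted hω v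
  simp only [IsState, smeared_apply, e, mul_one, integral_complex_ofReal, f.integral_eq_one,
    Complex.ofReal_one]

lemma isTranslationInvariant_smeared (h : N.ContinuousBoosts) (hinv : N.IsTranslationInvariant ω)
    (f : SmearingFunction) : N.IsTranslationInvariant (N.smeared h ω f) := fun p a => by
  simp only [smeared_apply, hinv.boosted _ p a]

lemma continuous_boosted (h : N.ContinuousBoosts) (ω : A →ₚ[ℂ] ℂ) (a : A) :
    Continuous fun v => N.boosted ω v a :=
  (map_continuous ω).comp (h.continuous a)

lemma _root_.SmearingFunction.continuous (f : SmearingFunction) : Continuous f.toFun :=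
  f.smooth.continuous

lemma _root_.SmearingFunction.integrable (f : SmearingFunction) : Integrable f.toFun :=
  f.continuous.integrable_of_hasCompactSupport f.hasCompactSupport

/-- Spatial clustering of the smeared state, component by component. -/
lemma tendsto_smeared_space (h : N.ContinuousBoosts) (hω : IsFactorState ω)
    (hinv : N.IsTranslationInvariant ω) (f : SmearingFunction) (a b : A) :
    Tendsto (fun x => N.smeared h ω f (a * N.σ x b)) (cocompact (EuclideanSpace ℝ (Fin ν)))
      (𝓝 (∫ v, (f.toFun v : ℂ) * (N.boosted ω v a * N.boosted ω v b))) := by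
  have := isCountablyGenerated_cocompact (E := EuclideanSpace ℝ (Fin ν))
  simp only [smeared_apply]
  refine tendsto_integral_filter_of_dominated_convergence (fun v => f.toFun v * (‖a‖ * ‖b‖))
    (Eventually.of_forall fun x => (integrable_smear h ω f _).aestronglyMeasurable)
    (Eventually.of_forall fun x => Eventually.of_forall fun v => ?_)
    (f.integrable.mul_const _) (Eventually.of_forall fun v => ?_)
  · rw [norm_mul, Complex.norm_real, Real.norm_of_nonneg (f.nonneg v)]
    gcongr
    · exact f.nonneg v
    · refine ((isState_boosted hω.1 v).norm_apply_le _).trans ((norm_mul_le _ _).trans_eq ?_)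
      rw [σ, ξ, N.norm_act]
  · exact (tendsto_apply_mul_of_isFactorState (hω.pullback _) (hinv.boosted v)
      (tendsto_norm_space ν) a b).const_mul _

/-- The time evolution, seen from two frames in relative motion, decorrelates. -/
lemma tendsto_apply_boosted_time (hω : IsFactorState ω) (hinv : N.IsTranslationInvariant ω)
    (b : A) {v w : ℝ} (hvw : v ≠ w) :
    Tendsto (fun t => ω (star (N.boostAut v (N.τ t b)) * N.boostAut w (N.τ t b))) atTop
      (𝓝 (star (N.boosted ω v b) * N.boosted ω w b)) := by
  -- By translation invariance only the difference of the two boosted points `(t, 0)` matters, and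
  -- it goes to space-like infinity.
  have hlim := tendsto_apply_mul_of_isFactorState hω hinv (tendsto_norm_boost_sub hvw)
    (star (N.boostAut v b)) (N.boostAut w b)
  rw [map_star] at hlim
  refine hlim.congr fun t => ?_
  rw [← hinv (boostFun v (t, 0)), map_mul, ← ξ_add, map_star, add_sub_cancel, τ, boostAut_ξ,
    boostAut_ξ]

/-- Clustering in time of the smeared state, component by component. -/
lemma tendsto_smeared_time (h : N.ContinuousBoosts) (hω : IsFactorState ω)
    (hinv : N.IsTranslationInvariant ω) (f : SmearingFunction) (a b : A) :
    Tendsto (fun t => N.smeared h ω f (a * N.τ t b)) atTop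
      (𝓝 (∫ v, (f.toFun v : ℂ) * (N.boosted ω v a * N.boosted ω v b))) := by
  set Ω := gnsVector ω with hΩ
  set π := ω.gnsStarAlgHom with hπ
  have hcont : ∀ c : A, Continuous fun v => π (N.boostAut v c) Ω := fun c => by
    have : Continuous π := map_continuous π
    exact (this.comp (h.continuous c)).clm_apply continuous_const
  -- All `ω_v` are realised in the one GNS space of `ω`. Subtracting the expectation makes the
  -- pairings of different rapidities tend to zero.
  let u : ℝ → ℝ → ω.GNS := fun t v => π (N.boostAut v (N.τ t b)) Ω - N.boosted ω v b • Ω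
  -- Chosen so that pairing with `u t v` and integrating gives `ω_f(a τ_t(b))` minus the claimed
  -- limit.
  let g : ℝ → ω.GNS := fun v => (f.toFun v : ℂ) • π (N.boostAut v (star a)) Ω
  have hgi : Integrable g := by
    refine Continuous.integrable_of_hasCompactSupport ?_ ?_
    · exact (Complex.continuous_ofReal.comp f.continuous).smul (hcont _)
    · exact (f.hasCompactSupport.comp_left (g := fun r : ℝ => (r : ℂ))
        Complex.ofReal_zero).smul_right
  have hΩ1 : ‖Ω‖ = 1 := norm_gnsVector hω.1
  have hτ : ∀ t v, ω (N.boostAut v (N.τ t b)) = N.boosted ω v b := fun t v =>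
    hinv.boosted v (t, 0) b
  have hinner : ∀ c : A, ⟪Ω, π c Ω⟫_ℂ = ω c := fun c => (eq_inner_gnsVector ω c).symm
  have hΩΩ : ⟪Ω, Ω⟫_ℂ = 1 := by simp [inner_self_eq_norm_sq_to_K, hΩ1]
  have hππ : ∀ c d : A, ⟪π c Ω, π d Ω⟫_ℂ = ω (star c * d) := inner_gns ω
  have hinner' : ∀ c : A, ⟪π c Ω, Ω⟫_ℂ = star (ω c) := fun c => by
    rw [← inner_conj_symm, hinner]; rfl
  have hlim : Tendsto (fun t => ∫ v, ⟪g v, u t v⟫_ℂ) atTop (𝓝 0) := by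
    refine tendsto_integral_inner_zero_of_asymptotically_orthogonal (u := u) (C := ‖b‖ + ‖b‖)
      (fun t => (hcont (N.τ t b)).sub ((continuous_boosted h ω b).smul continuous_const))
      (fun t v => (norm_sub_le _ _).trans (add_le_add ?_ ?_)) (fun v w hvw => ?_) hgi
    · refine (norm_gns_le hω.1 _).trans_eq ?_
      rw [boostAut, norm_act, τ, ξ, norm_act]
    · rw [norm_smul, hΩ1, mul_one]
      exact ((isState_boosted hω.1 v).norm_apply_le b)
    · have h1 := (tendsto_apply_boosted_time hω hinv b hvw).sub_const
        (star (N.boosted ω v b) * N.boosted ω w b)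
      rw [sub_self] at h1
      refine h1.congr fun t => ?_
      simp only [u, inner_sub_left, inner_sub_right, inner_smul_left, inner_smul_right, hinner,
        hinner', hτ, hΩΩ, hππ, ← Complex.star_def]
      ring
  have hsub : ∀ t, ∫ v, ⟪g v, u t v⟫_ℂ = N.smeared h ω f (a * N.τ t b) -
      ∫ v, (f.toFun v : ℂ) * (N.boosted ω v a * N.boosted ω v b) := fun t => by
    rw [smeared_apply, ← integral_sub (integrable_smear h ω f _)]
    · congr 1 with v
      have e : ⟪π (N.boostAut v (star a)) Ω, π (N.boostAut v (N.τ t b)) Ω⟫_ℂ =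
          N.boosted ω v (a * N.τ t b) := by
        rw [hππ, boosted_apply, map_star, star_star, map_mul (N.boostAut v)]
      simp only [g, u, inner_sub_right, inner_smul_left, inner_smul_right, e, hinner',
        Complex.conj_ofReal]
      rw [map_star, map_star, star_star, ← boosted_apply]
      ring
    · refine Continuous.integrable_of_hasCompactSupport ?_ ?_
      · exact (Complex.continuous_ofReal.comp f.continuous).mul
          ((continuous_boosted h ω a).mul (continuous_boosted h ω b))
      · exact (f.hasCompactSupport.comp_left (g := fun r : ℝ => (r : ℂ))
          Complex.ofReal_zero).mul_right
  simp only [hsub] at hlim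
  simpa using hlim.add_const (∫ v, (f.toFun v : ℂ) * (N.boosted ω v a * N.boosted ω v b))

lemma boosted_zero (N : HaagKastlerNet ν A) (ω : A →ₚ[ℂ] ℂ) : N.boosted ω 0 = ω := by
  ext a
  rw [boosted_apply, boostAut, boost_zero, map_one]
  rfl

lemma boosted_add (N : HaagKastlerNet ν A) (ω : A →ₚ[ℂ] ℂ) (v w : ℝ) :
    N.boosted ω (v + w) = N.boosted (N.boosted ω v) w := by
  ext a
  simp only [boosted_apply, boostAut_add]

/-- A state whose boosts agree on a nonempty open set of rapidities is boost invariant. -/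
lemma boosted_eq_of_eqOn_open {s : Set ℝ} (hs : IsOpen s) (hne : s.Nonempty)
    {φ : A →ₚ[ℂ] ℂ} (hφ : ∀ v ∈ s, N.boosted ω v = φ) (v : ℝ) : N.boosted ω v = ω := by
  obtain ⟨v₀, hv₀⟩ := hne
  let G : AddSubgroup ℝ :=
    { carrier := {v | N.boosted ω v = ω}
      add_mem' := fun {v w} hv hw => by
        rw [Set.mem_ofPred_eq] at hv hw ⊢
        rw [boosted_add, hv, hw]
      zero_mem' := boosted_zero N ω
      neg_mem' := fun {v} hv => by
        rw [Set.mem_ofPred_eq] at hv ⊢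
        nth_rewrite 1 [← hv]
        rw [← boosted_add, add_neg_cancel, boosted_zero] }
  -- Differences of rapidities in `s` fix `ω`, so `G` contains a neighbourhood of `0`; an open
  -- subgroup is also closed, and `ℝ` is connected.
  have hsub : (fun v => v - v₀) '' s ⊆ (G : Set ℝ) := by
    rintro _ ⟨v, hv, rfl⟩
    change N.boosted ω (v - v₀) = ω
    rw [sub_eq_add_neg, boosted_add, hφ v hv, ← hφ v₀ hv₀, ← boosted_add, add_neg_cancel,
      boosted_zero]
  have hopen : IsOpen (G : Set ℝ) := G.isOpen_of_mem_nhds (g := 0)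
    (mem_of_superset (((Homeomorph.subRight v₀).isOpenMap s hs).mem_nhds
      ⟨v₀, hv₀, sub_self v₀⟩) hsub)
  have huniv : (G : Set ℝ) = Set.univ :=
    IsClopen.eq_univ ⟨G.isClosed_of_isOpen hopen, hopen⟩ ⟨0, G.zero_mem⟩
  exact (huniv ▸ Set.mem_univ v : v ∈ (G : Set ℝ))

/-- If the smeared state is a factor state, then the original state is boost invariant. -/
lemma boosted_eq_of_isFactorState_smeared (h : N.ContinuousBoosts) (hω : IsFactorState ω)
    (hinv : N.IsTranslationInvariant ω) (f : SmearingFunction)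
    (hf : IsFactorState (N.smeared h ω f)) (v : ℝ) : N.boosted ω v = ω := by
  -- Two evaluations of the same spatial limit: component by component, and by clustering of the
  -- supposed factor state.
  have hmul : ∀ a b, ∫ v, (f.toFun v : ℂ) * (N.boosted ω v a * N.boosted ω v b) =
      N.smeared h ω f a * N.smeared h ω f b := fun a b =>
    tendsto_nhds_unique (tendsto_smeared_space h hω hinv f a b)
      (tendsto_apply_mul_of_isFactorState hf (isTranslationInvariant_smeared h hinv f)
        (tendsto_norm_space ν) a b)
  refine boosted_eq_of_eqOn_open (s := {v | f.toFun v ≠ 0}) (φ := N.smeared h ω f)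
    (isOpen_ne.preimage f.continuous) ?_ (fun v hv => ?_) v
  · by_contra! hempty
    have h0 : ∀ v, f.toFun v = 0 := fun v => by
      by_contra hv
      exact (hempty ▸ hv : v ∈ (∅ : Set ℝ))
    have h1 := f.integral_eq_one
    simp [h0] at h1
  · ext b
    set m := N.smeared h ω f b with hm
    -- For the centred observable, `hmul (star c) c` says that the variance of `w ↦ ω_w(b)` with
    -- respect to `f(w) dw` is zero.
    set c : A := b - m • 1
    have hc : N.smeared h ω f c = 0 := by
      rw [map_sub, map_smul, isState_smeared h hω.1 f, ← hm]; simp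
    have hcv : ∀ w, N.boosted ω w c = N.boosted ω w b - m := fun w => by
      rw [map_sub, map_smul, isState_boosted hω.1 w]; simp
    have h1 := hmul (star c) c
    rw [hc, mul_zero] at h1
    have h2 : ∫ w, f.toFun w * ‖N.boosted ω w b - m‖ ^ 2 = 0 := by
      rw [← Complex.ofReal_inj, ← integral_complex_ofReal, Complex.ofReal_zero, ← h1]
      congr 1 with w
      rw [map_star, hcv]
      push_cast
      rw [← Complex.conj_mul']
      rfl
    have hcont : Continuous fun w => f.toFun w * ‖N.boosted ω w b - m‖ ^ 2 :=
      f.continuous.mul (((continuous_boosted h ω b).sub continuous_const).norm.pow 2)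
    have hint : Integrable fun w => f.toFun w * ‖N.boosted ω w b - m‖ ^ 2 :=
      hcont.integrable_of_hasCompactSupport f.hasCompactSupport.mul_right
    have h3 := (integral_eq_zero_iff_of_nonneg
      (fun w => mul_nonneg (f.nonneg w) (sq_nonneg _)) hint).1 h2
    -- Continuity upgrades vanishing almost everywhere to vanishing at the given rapidity.
    have h4 := congrFun ((hcont.ae_eq_iff_eq volume continuous_const).1 h3) v
    rcases mul_eq_zero.1 h4 with h5 | h5
    · exact absurd h5 hv
    · exact sub_eq_zero.1 (norm_eq_zero.1 (pow_eq_zero_iff two_ne_zero |>.1 h5))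

/-- The mean at space-like infinity of an observable in the smeared state, as an element of the
centre. -/
lemma exists_gnsCenter_smeared (h : N.ContinuousBoosts) (hω : IsFactorState ω)
    (hinv : N.IsTranslationInvariant ω) (f : SmearingFunction) (b : A) :
    ∃ T ∈ gnsCenter (N.smeared h ω f), ∀ a,
      ⟪(N.smeared h ω f).gnsStarAlgHom (star a) (gnsVector (N.smeared h ω f)),
        T (gnsVector (N.smeared h ω f))⟫_ℂ =
      ∫ v, (f.toFun v : ℂ) * (N.boosted ω v a * N.boosted ω v b) := by
  set φ := N.smeared h ω f
  -- Any ultrafilter will do: the matrix elements of `T` are limits along the whole of `cocompact`.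
  set U := Ultrafilter.of (cocompact (EuclideanSpace ℝ (Fin ν)))
  have hU : (U : Filter (EuclideanSpace ℝ (Fin ν))) ≤ cocompact _ := Ultrafilter.of_le _
  obtain ⟨T, hT, hlim⟩ := N.exists_mem_gnsCenter_tendsto φ ((tendsto_norm_space ν).mono_left hU) b
  refine ⟨T, hT, fun a => ?_⟩
  have h1 := hlim (φ.gnsStarAlgHom (star a) (gnsVector φ)) (gnsVector φ)
  simp only [inner_gns, star_star] at h1
  exact tendsto_nhds_unique h1 ((tendsto_smeared_space h hω hinv f a b).mono_left hU)

end HaagKastlerNet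

theorem theorem1 {ν : ℕ} [NeZero ν] {A : Type*} [CStarAlgebra A] [PartialOrder A]
    [StarOrderedRing A] (N : HaagKastlerNet ν A)
    (hτσ : N.ContinuousTranslations) (hboost : N.ContinuousBoosts)
    (ω : A →ₚ[ℂ] ℂ) (hω : IsPureState ω ∨ IsFactorState ω)
    (hinv : N.IsTranslationInvariant ω) (hext : N.IsExtremalSpaceInvariant ω) :
    (∀ v : ℝ, N.IsExtremalSpaceInvariant (N.boosted ω v) ∧
      N.IsTimeInvariant (N.boosted ω v) ∧ IsFactorState (N.boosted ω v)) ∧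
    ∀ f : SmearingFunction,
      IsState (N.smeared hboost ω f) ∧
      ((∃ v : ℝ, N.boosted ω v ≠ ω) → ¬ IsFactorState (N.smeared hboost ω f)) ∧
      ∃ hf : N.IsTranslationInvariant (N.smeared hboost ω f),
        ∀ B : A, ∃ Bf ∈ gnsCenter (N.smeared hboost ω f),
          (∀ x, N.σExt hf x Bf = Bf) ∧ (∀ t, N.τExt hf t Bf = Bf) ∧
          (∀ a : A,
            gnsExt (N.smeared hboost ω f) ((N.smeared hboost ω f).gnsStarAlgHom a * Bf) =
              gnsExt (N.smeared hboost ω f) (Bf * (N.smeared hboost ω f).gnsStarAlgHom a)) ∧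
          (∀ a : A, Tendsto (fun x : EuclideanSpace ℝ (Fin ν) =>
            gnsExt (N.smeared hboost ω f) ((N.smeared hboost ω f).gnsStarAlgHom a *
              N.σExt hf x ((N.smeared hboost ω f).gnsStarAlgHom B - Bf)))
            (cocompact (EuclideanSpace ℝ (Fin ν))) (𝓝 0)) ∧
          (∀ a : A, Tendsto (fun t : ℝ =>
            gnsExt (N.smeared hboost ω f) ((N.smeared hboost ω f).gnsStarAlgHom a *
              N.τExt hf t ((N.smeared hboost ω f).gnsStarAlgHom B - Bf)))
            atTop (𝓝 0)) := by
  have hfac : IsFactorState ω := hω.elim IsPureState.isFactorState id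
  refine ⟨fun v => ⟨?_, fun t => hinv.boosted v (t, 0), hfac.pullback _⟩, fun f =>
    ⟨HaagKastlerNet.isState_smeared hboost hfac.1 f, fun ⟨v, hv⟩ hf =>
      hv (HaagKastlerNet.boosted_eq_of_isFactorState_smeared hboost hfac hinv f hf v),
    HaagKastlerNet.isTranslationInvariant_smeared hboost hinv f, fun B => ?_⟩⟩
  · exact HaagKastlerNet.isExtremalSpaceInvariant_of_isFactorState (hfac.pullback _) (hinv.boosted v)
  obtain ⟨T, hT, hTlim⟩ := HaagKastlerNet.exists_gnsCenter_smeared hboost hfac hinv f B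
  have hcomm := (mem_gnsCenter_iff.1 hT).2
  have hfinv := HaagKastlerNet.isTranslationInvariant_smeared hboost hinv f
  have hfix : ∀ p : Spacetime ν, gnsAut (N.smeared hboost ω f) (N.ξ p) (hfinv p) T = T := by
    intro p
    -- Centrality moves the right-hand algebra element across `T`, so all matrix elements are
    -- expressed by the translation invariant `ω_v`.
    have hmat : ∀ a b, ⟪(N.smeared hboost ω f).gnsStarAlgHom a (gnsVector _),
        T ((N.smeared hboost ω f).gnsStarAlgHom b (gnsVector _))⟫_ℂ =
        ∫ v, (f.toFun v : ℂ) * (N.boosted ω v (star a * b) * N.boosted ω v B) := by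
      intro a b
      have e := DFunLike.congr_fun (hcomm b).eq (gnsVector _)
      rw [mul_apply_eq_comp, mul_apply_eq_comp] at e
      rw [← hTlim, star_mul, star_star, map_mul, mul_apply_eq_comp, e,
        inner_gnsStarAlgHom_left _ (star b), star_star]
    refine gnsAut_eq_self _ fun a b => ?_
    simp only [hmat, ← map_star, ← map_mul, hinv.boosted _ p]
  refine ⟨T, hT, fun x => hfix (0, x), fun t => hfix (t, 0), fun a => by rw [(hcomm a).eq],
    fun a => ?_, fun a => ?_⟩
  -- As `T` is fixed by translations, the `T` term does not depend on `x`; it equals the spatial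
  -- limit of the first term.
  · have hlim := (HaagKastlerNet.tendsto_smeared_space hboost hfac hinv f a B).sub_const
      (∫ v, (f.toFun v : ℂ) * (N.boosted ω v a * N.boosted ω v B))
    rw [sub_self] at hlim
    refine hlim.congr fun x => ?_
    have e : N.σExt hfinv x T = T := hfix (0, x)
    have e' : N.σExt hfinv x ((N.smeared hboost ω f).gnsStarAlgHom B) =
        (N.smeared hboost ω f).gnsStarAlgHom (N.σ x B) :=
      gnsAut_gnsStarAlgHom _ (N.σ x) (hfinv (0, x)) B
    rw [map_sub, e, e', gnsExt_gnsStarAlgHom_mul,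
      sub_apply, inner_sub_right, hTlim, inner_gns, star_star]
  -- The same `T` serves, because the time limit is the same integral as the spatial one.
  · have hlim := (HaagKastlerNet.tendsto_smeared_time hboost hfac hinv f a B).sub_const
      (∫ v, (f.toFun v : ℂ) * (N.boosted ω v a * N.boosted ω v B))
    rw [sub_self] at hlim
    refine hlim.congr fun t => ?_
    have e : N.τExt hfinv t T = T := hfix (t, 0)
    have e' : N.τExt hfinv t ((N.smeared hboost ω f).gnsStarAlgHom B) =
        (N.smeared hboost ω f).gnsStarAlgHom (N.τ t B) :=
      gnsAut_gnsStarAlgHom _ (N.τ t) (hfinv (t, 0)) B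
    rw [map_sub, e, e', gnsExt_gnsStarAlgHom_mul,
      sub_apply, inner_sub_right, hTlim, inner_gns, star_star]
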